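/- Let $m,n\ge 2$, and regard $\mathbb{C}^{m\times n}$ as a real vector space, of dimension $2mn$. Let $\mathcal{M}\subset\mathbb{C}^{m\times n}$ be the set of matrices with a repeated singular value, that is, the matrices for which two of the $\min(m,n)$ singular values (counted with multiplicity) coincide. Then $\mathcal{M}$ has real codimension $3$ in $\mathbb{C}^{m\times n}$, in the following sense: $\mathcal{M}$ is not empty, and it has a relatively open and dense subset $\mathcal{R}\subseteq\mathcal{M}$ such that $\mathcal{R}$ is an embedded smooth ($C^\infty$) real submanifold of $\mathbb{C}^{m\times n}$ of dimension $2mn-3$, and $\mathcal{M}\setminus\mathcal{R}$ is a finite union of embedded smooth real submanifolds of $\mathbb{C}^{m\times n}$ of dimensions smaller than $2mn-3$. -/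

import Mathlib

open scoped ContDiff

/- The vector space of complex matrices carries the entrywise sup norm. It is a finite-dimensional
real vector space, so its topology and its smooth structure do not depend on the norm. -/
attribute [local instance] Matrix.normedAddCommGroup Matrix.normedSpace

/-- `S` is an embedded smooth (`C^∞`) submanifold of dimension `d` of the real vector space `E`:
around each point of `S` there is a smooth chart of `E` (a `C^∞` diffeomorphism between open
subsets of `E`) that carries `S` onto a `d`-dimensional linear slice. -/
def IsSmoothSubmanifold {E : Type*} [NormedAddCommGroup E] [NormedSpace ℝ E]
    (d : ℕ) (S : Set E) : Prop :=
  ∀ x ∈ S, ∃ (φ : OpenPartialHomeomorph E E) (W : Submodule ℝ E),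
    x ∈ φ.source ∧
    ContDiffOn ℝ ∞ φ φ.source ∧
    ContDiffOn ℝ ∞ φ.symm φ.target ∧
    Module.finrank ℝ W = d ∧
    φ.source ∩ S = φ.source ∩ φ ⁻¹' (W : Set E)

/-- `S ⊆ E` has (real) codimension `c` in `E`, for sets that may have singular points: `S` is not
empty and, away from a singular part of larger codimension, it is an embedded smooth submanifold
`R` of dimension `dim E - c`. Precisely, `R` is open and dense in `S`, and the singular part
`S \ R` is a finite union of embedded smooth submanifolds of dimensions less than `dim R`.
If `S` is itself a nonempty submanifold of `E` of dimension `d`, then `R = S` is a valid choice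
and `c = dim E - d`. -/
def HasRealCodimension {E : Type*} [NormedAddCommGroup E] [NormedSpace ℝ E]
    (S : Set E) (c : ℕ) : Prop :=
  S.Nonempty ∧
  ∃ (d : ℕ) (R : Set E),
    d + c = Module.finrank ℝ E ∧
    IsSmoothSubmanifold d R ∧
    (∃ U : Set E, IsOpen U ∧ R = S ∩ U) ∧
    S ⊆ closure R ∧
    ∃ (k : ℕ) (T : Fin k → Set E) (e : Fin k → ℕ),
      S \ R = ⋃ i, T i ∧
      ∀ i, e i < d ∧ IsSmoothSubmanifold (e i) (T i)

/-- The `i`-th singular value of the complex `m × n` matrix `A`, counted from `0` and in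
nonincreasing order. The `m × n` matrix has `min m n` singular values, those with
`i < min m n`. -/
noncomputable def matrixSingularValue {m n : ℕ} (A : Matrix (Fin m) (Fin n) ℂ) (i : ℕ) : ℝ :=
  (Matrix.toEuclideanLin A).singularValues i

/-- The complex `m × n` matrices with a repeated singular value: two of the `min m n` singular
values, counted with multiplicity, coincide. -/
def repeatedSingularValueSet (m n : ℕ) : Set (Matrix (Fin m) (Fin n) ℂ) :=
  {A | ∃ i j : ℕ, i < j ∧ j < min m n ∧ matrixSingularValue A i = matrixSingularValue A j}

/-! Stratify the matrices by the rank `ρ`, the number `r` of distinct positive singular values, and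
the sum `c` of the squares of their multiplicities. Every nonempty stratum is a submanifold of
codimension `c - r + 2 (m - ρ) (n - ρ)`, for the following reason.

Near `A₀`, let `μ` be a positive eigenvalue of `A₀ᴴ * A₀` of multiplicity `k`. A number `x` near `μ`
is an eigenvalue of `Aᴴ * A` of multiplicity at most `k`, with equality iff a `k × k` Schur
complement vanishes (`rank_add_schurComplement`). It is Hermitian, so this is `k ^ 2` real
equations, and the unknown `x` gives back one dimension. Keeping the rank is the vanishing of an `(m
- ρ) × (n - ρ)` complex Schur complement. Together these equations in `A` and the unknown
eigenvalues form a submersion at `A₀` that is immersive in the eigenvalues; the implicit function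
theorem eliminates the eigenvalues (`hasSliceChartAt_of_parametric_submersion`).

Put `p = min m n`. A matrix has no repeated singular value iff `r = ρ ≥ p - 1`, so the set in
question is a finite union of strata. The generic one has full rank and a single double value: `ρ =
p`, `r = p - 1`, `c = (p - 2) + 4`, of codimension `3`. The inequality `k ^ 2 - 1 ≥ 3 (k - 1)` shows
that all the others have codimension at least `4`. The generic stratum is relatively open because
the rank and the number of distinct positive singular values are lower semicontinuous, and dense
because the singular values in a singular value decomposition can be moved apart while one
coincidence is kept. -/

open Filter Topology

/-! ### Slice charts from analytic submersions, with and without parameters. -/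

section SliceCharts

/-- `S` is, near the point `x`, carried onto a `d`-dimensional linear slice by a smooth chart. -/
def HasSliceChartAt {E : Type*} [NormedAddCommGroup E] [NormedSpace ℝ E]
    (d : ℕ) (S : Set E) (x : E) : Prop :=
  ∃ (φ : OpenPartialHomeomorph E E) (W : Submodule ℝ E),
    x ∈ φ.source ∧
    ContDiffOn ℝ ∞ φ φ.source ∧
    ContDiffOn ℝ ∞ φ.symm φ.target ∧
    Module.finrank ℝ W = d ∧
    φ.source ∩ S = φ.source ∩ φ ⁻¹' (W : Set E)

variable {E P G : Type*} [NormedAddCommGroup E] [NormedSpace ℝ E] [FiniteDimensional ℝ E]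
  [NormedAddCommGroup P] [NormedSpace ℝ P] [FiniteDimensional ℝ P]
  [NormedAddCommGroup G] [NormedSpace ℝ G] [FiniteDimensional ℝ G]

/-- The zero set of an analytic submersion is a submanifold. -/
theorem hasSliceChartAt_of_submersion {F : E → G} {x : E} {S : Set E} {d : ℕ}
    (hF : ContDiffAt ℝ ω F x) {L : E →L[ℝ] G} (hL : HasFDerivAt F L x)
    (hsurj : Function.Surjective L)
    (hS : ∀ᶠ y in 𝓝 x, y ∈ S ↔ F y = 0)
    (hd : d + Module.finrank ℝ G = Module.finrank ℝ E) :
    HasSliceChartAt d S x := by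
  obtain ⟨R₀, hR₀⟩ := L.toLinearMap.exists_rightInverse_of_surjective
    (LinearMap.range_eq_top.mpr hsurj)
  have hR : ∀ g, L (R₀ g) = g := fun g => by simpa using LinearMap.congr_fun hR₀ g
  let R : G →L[ℝ] E := R₀.toContinuousLinearMap
  have hR' : ∀ g, L (R g) = g := hR
  -- The chart: its derivative at `x` is the identity, and `L ∘ f = F`, so it carries the zeros of
  -- `F` into `ker L` and nothing else there.
  let f : E → E := fun y => y - R (L y) + R (F y)
  have hf : ContDiffAt ℝ ω f x := by
    have h1 : ContDiffAt ℝ ω (fun y => R (L y)) x :=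
      (R.contDiff.comp L.contDiff).contDiffAt
    have h2 : ContDiffAt ℝ ω (fun y => R (F y)) x :=
      (R.contDiff.contDiffAt).comp x hF
    exact (contDiffAt_id.sub h1).add h2
  have hf' : HasFDerivAt f ((ContinuousLinearEquiv.refl ℝ E : E ≃L[ℝ] E) : E →L[ℝ] E) x := by
    have h1 : HasFDerivAt (fun y => R (L y)) (R.comp L) x := (R.comp L).hasFDerivAt
    have h2 : HasFDerivAt (fun y => R (F y)) (R.comp L) x := R.hasFDerivAt.comp x hL
    have h3 := ((hasFDerivAt_id x).sub h1).add h2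
    refine h3.congr_fderiv ?_
    ext v; simp
  have hω : (ω : WithTop ℕ∞) ≠ 0 := by simp
  set φ := hf.toOpenPartialHomeomorph f hf' hω with hφ
  have hφf : ∀ y, φ y = f y := fun y => rfl
  have hxs : x ∈ φ.source := hf.mem_toOpenPartialHomeomorph_source hf' hω
  have hsym : ContDiffAt ℝ ω φ.symm (φ x) := by
    apply φ.contDiffAt_symm (f₀' := ContinuousLinearEquiv.refl ℝ E) (φ.map_source hxs)
    · rw [φ.left_inv hxs]; exact hf'
    · rw [φ.left_inv hxs]; exact hf
  -- This is the use of `ω`: analyticity at a point spreads to a neighbourhood, which `C^∞` at a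
  -- point need not do.
  have e1 : ∀ᶠ y in 𝓝 x, ContDiffAt ℝ ω f y := hf.eventually (by simp)
  have e2 : ∀ᶠ y in 𝓝 x, ContDiffAt ℝ ω φ.symm (φ y) :=
    (φ.continuousAt hxs).eventually (hsym.eventually (by simp))
  obtain ⟨O, hO, hOopen, hxO⟩ := eventually_nhds_iff.mp (e1.and (e2.and hS))
  refine ⟨φ.restrOpen O hOopen, LinearMap.ker L.toLinearMap, ⟨hxs, hxO⟩, ?_, ?_, ?_, ?_⟩
  · intro y hy
    exact ((hO y hy.2).1.of_le (by simp)).contDiffWithinAt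
  · intro z hz
    have hz1 : z ∈ φ.target := by
      have : z ∈ φ.target ∩ φ.symm ⁻¹' O := by simpa using hz
      exact this.1
    have hz2 : φ.symm z ∈ O := by
      have : z ∈ φ.target ∩ φ.symm ⁻¹' O := by simpa using hz
      exact this.2
    have h := (hO _ hz2).2.1
    rw [φ.right_inv hz1] at h
    exact (h.of_le (by simp)).contDiffWithinAt
  · have h1 := L.toLinearMap.finrank_range_add_finrank_ker
    rw [LinearMap.range_eq_top.mpr hsurj, finrank_top] at h1
    omega
  · ext y
    constructor
    · rintro ⟨hy, hyS⟩
      refine ⟨hy, ?_⟩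
      have h0 := (hO y hy.2).2.2.mp hyS
      change L (y - R (L y) + R (F y)) = 0
      simp [hR', h0]
    · rintro ⟨hy, hyW⟩
      refine ⟨hy, (hO y hy.2).2.2.mpr ?_⟩
      have : L (y - R (L y) + R (F y)) = 0 := hyW
      simpa [hR'] using this

/-- A set that is locally the projection of the zero set of an analytic submersion `Φ` depending
on parameters is a submanifold, provided that `Φ` is immersive in the parameters. -/
theorem hasSliceChartAt_of_parametric_submersion {Φ : E × P → G} {x : E} {p : P} {S : Set E}
    {d : ℕ} (hΦ : ContDiffAt ℝ ω Φ (x, p)) {L : E × P →L[ℝ] G} (hL : HasFDerivAt Φ L (x, p))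
    (h0 : Φ (x, p) = 0)
    (hsurj : Function.Surjective L)
    (hinj : ∀ q : P, L (0, q) = 0 → q = 0)
    (hS : ∀ᶠ ε in 𝓝[>] (0 : ℝ), ∀ᶠ y in 𝓝 x, y ∈ S ↔ ∃ q, dist q p < ε ∧ Φ (y, q) = 0)
    (hd : d + Module.finrank ℝ G = Module.finrank ℝ E + Module.finrank ℝ P) :
    HasSliceChartAt d S x := by
  let L₂ : P →L[ℝ] G := L.comp (ContinuousLinearMap.inr ℝ E P)
  have hker : LinearMap.ker L₂.toLinearMap = ⊥ := by
    rw [LinearMap.ker_eq_bot']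
    intro q hq
    exact hinj q (by simpa [L₂] using hq)
  -- The equations split in two: those in `π ∘ Φ` determine the parameter as `q = ψ y`; those left,
  -- in `ker π`, cut out `S`.
  obtain ⟨π₀, hπ₀⟩ := L₂.toLinearMap.exists_leftInverse_of_injective hker
  let π : G →L[ℝ] P := π₀.toContinuousLinearMap
  have hπ : ∀ q, π (L (0, q)) = q := fun q => by
    change π₀ (L (0, q)) = q
    simpa [L₂] using LinearMap.congr_fun hπ₀ q
  let f : E × P → P := fun z => π (Φ z)
  have hf : ContDiffAt ℝ ω f (x, p) := π.contDiff.contDiffAt.comp _ hΦ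
  have hfd : HasFDerivAt f (π.comp L) (x, p) := π.hasFDerivAt.comp _ hL
  have hinv : (fderiv ℝ f (x, p) ∘L .inr ℝ E P).IsInvertible := by
    rw [hfd.fderiv]
    refine ⟨ContinuousLinearEquiv.refl ℝ P, ?_⟩
    ext q; simp [hπ]
  have hω : (ω : WithTop ℕ∞) ≠ 0 := by simp
  have f0 : f (x, p) = 0 := by simp [f, h0]
  set ψ := hf.implicitFunction hω hinv with hψ
  have ψ0 : ψ x = p := hf.implicitFunction_apply_self hω hinv
  have hψc : ContDiffAt ℝ ω ψ x := hf.contDiffAt_implicitFunction hω hinv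
  have hψe : ∀ᶠ y in 𝓝 x, f (y, ψ y) = 0 := by
    simpa [f0] using hf.eventually_apply_implicitFunction hω hinv
  have hψi : ∀ᶠ v in 𝓝 (x, p), f v = 0 ↔ ψ v.1 = v.2 := by
    simpa [f0] using hf.eventually_apply_eq_iff_implicitFunction hω hinv
  let K := LinearMap.ker π.toLinearMap
  let Q₀ : G →ₗ[ℝ] K := LinearMap.codRestrict K
    -- The projection onto `ker π` along the range of `L₂`. It kills the derivative in the
    -- parameter, so the derivative of `ψ` does not affect surjectivity.
    (LinearMap.id - L₂.toLinearMap ∘ₗ π.toLinearMap) (fun g => by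
      simp [K, L₂, hπ])
  let Q : G →L[ℝ] K := Q₀.toContinuousLinearMap
  have hQ : ∀ g, (Q g : G) = g - L (0, π g) := fun g => by
    simp [Q, Q₀, L₂]
  let F : E → K := fun y => Q (Φ (y, ψ y))
  obtain ⟨ψ', hψ'⟩ : ∃ ψ' : E →L[ℝ] P, HasFDerivAt ψ ψ' x :=
    ⟨_, (hψc.differentiableAt hω).hasFDerivAt⟩
  have hgraph : HasFDerivAt (fun y => (y, ψ y)) ((ContinuousLinearMap.id ℝ E).prod ψ') x :=
    (hasFDerivAt_id x).prodMk hψ'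
  have hFd : HasFDerivAt F (Q.comp (L.comp ((ContinuousLinearMap.id ℝ E).prod ψ'))) x := by
    have h1 : HasFDerivAt Φ L (x, ψ x) := by rwa [ψ0]
    exact Q.hasFDerivAt.comp x (HasFDerivAt.comp x h1 hgraph)
  have hFc : ContDiffAt ℝ ω F x := by
    have h1 : ContDiffAt ℝ ω Φ (x, ψ x) := by rwa [ψ0]
    exact Q.contDiff.contDiffAt.comp x
      (ContDiffAt.comp x h1 (contDiffAt_id.prodMk hψc))
  refine hasSliceChartAt_of_submersion hFc hFd ?_ ?_ (S := S) ?_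
  · rintro ⟨g, hg⟩
    have hg' : π g = 0 := hg
    obtain ⟨⟨v, q⟩, hv⟩ := hsurj g
    refine ⟨v, ?_⟩
    apply Subtype.ext
    have e : L (v, ψ' v) = g + L (0, ψ' v - q) := by
      rw [← hv, ← map_add]; simp
    change (Q (L (v, ψ' v)) : G) = g
    rw [hQ, e]
    simp only [map_add, hg', hπ, zero_add]
    abel
  · obtain ⟨ε₀, hε₀, hb⟩ := Metric.eventually_nhds_iff.mp hψi
    have hlt : ∀ᶠ ε in 𝓝[>] (0 : ℝ), ε < ε₀ ∧ 0 < ε := by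
      filter_upwards [Ioo_mem_nhdsGT hε₀] with ε hε using ⟨hε.2, hε.1⟩
    -- The radius `ε` is fixed inside the region where `ψ` is the only solution before `y` is
    -- brought close to `x`.
    obtain ⟨ε, hε, hε1, hε2⟩ := (hS.and hlt).exists
    have c1 : ∀ᶠ y in 𝓝 x, dist (ψ y) p < ε := by
      have := hψc.continuousAt.tendsto
      rw [ψ0] at this
      exact this.eventually (Metric.ball_mem_nhds p hε2)
    have c2 : ∀ᶠ y in 𝓝 x, dist y x < ε := Metric.ball_mem_nhds x hε2
    filter_upwards [hε, c1, c2, hψe] with y hy hy1 hy2 hy3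
    rw [hy]
    constructor
    · rintro ⟨q, hq, hq0⟩
      have hd : dist (y, q) (x, p) < ε₀ := by
        rw [Prod.dist_eq]; exact (max_lt hy2 hq).trans hε1
      have := (hb hd).mp (by simp [f, hq0])
      simp only at this
      simp [F, this, hq0]
    · intro h
      refine ⟨ψ y, hy1, ?_⟩
      have h1 : (Q (Φ (y, ψ y)) : G) = 0 := by
        have : Q (Φ (y, ψ y)) = 0 := h
        rw [this]; rfl
      have h2 : π (Φ (y, ψ y)) = 0 := hy3
      have h3 : L ((0 : E), (0 : P)) = 0 := L.map_zero
      rw [hQ, h2, h3, sub_zero] at h1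
      exact h1
  · have h1 := π.toLinearMap.finrank_range_add_finrank_ker
    have h2 : LinearMap.range π.toLinearMap = ⊤ :=
      LinearMap.range_eq_top.mpr fun q => ⟨L (0, q), hπ q⟩
    rw [h2, finrank_top] at h1
    have h3 : Module.finrank ℝ K = Module.finrank ℝ (LinearMap.ker π.toLinearMap) := rfl
    omega

end SliceCharts

/-! ### Rank of a perturbed matrix by a Schur complement. -/

section SchurComplement

open Matrix

variable {m n k l : Type*} [Fintype m] [DecidableEq m] [Fintype n] [DecidableEq n]
  [Fintype k] [Fintype l]

/-- A generalized Schur complement of `T + D`, where `G` is a generalized inverse of `T`, the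
columns of `ι` span the kernel of `T` and the rows of `π` cut out its range. It is scaled by a
determinant to be polynomial in `D`. -/
noncomputable def schurComplement (π : Matrix l m ℂ) (G : Matrix n m ℂ) (ι : Matrix n k ℂ)
    (D : Matrix m n ℂ) : Matrix l k ℂ :=
  π * (D * (adjugate (1 + G * D) * ι))

/-- With `Q = 1 + G * D`, the matrix `X = (T + D) * Q⁻¹` has the rank of `T + D` and satisfies `G *
X = 1 - ι * κ`. Hence `ker X` lies in the range of `ι`, of dimension `card k`, and fills it iff `X *
ι = 0`. As `G * X * ι = 0`, the relation `T * G = 1 - j * π` makes this equivalent to `π * X * ι =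
0`, which is the Schur complement up to the factor `Q.det`. -/
theorem rank_add_schurComplement [DecidableEq k] {T D : Matrix m n ℂ} {ι : Matrix n k ℂ} {κ : Matrix k n ℂ}
    {π : Matrix l m ℂ} {j : Matrix m l ℂ} {G : Matrix n m ℂ}
    (hGT : G * T = 1 - ι * κ) (hTG : T * G = 1 - j * π) (hκG : κ * G = 0) (hκι : κ * ι = 1)
    (hπT : π * T = 0) (hdet : (1 + G * D).det ≠ 0) :
    Fintype.card n ≤ (T + D).rank + Fintype.card k ∧
      ((T + D).rank + Fintype.card k = Fintype.card n ↔ schurComplement π G ι D = 0) := by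
  set Q := 1 + G * D with hQ
  have hu : IsUnit Q.det := isUnit_iff_ne_zero.mpr hdet
  have hQQ : Q * Q⁻¹ = 1 := mul_nonsing_inv _ hu
  set X := (T + D) * Q⁻¹ with hX
  have hrank : X.rank = (T + D).rank := by
    rw [hX]
    apply rank_mul_eq_left_of_isUnit_det
    exact isUnit_nonsing_inv_det _ hu
  have hκQ : κ * Q⁻¹ = κ := by
    have h1 : κ * Q = κ := by
      rw [hQ, Matrix.mul_add, Matrix.mul_one, ← Matrix.mul_assoc, hκG, Matrix.zero_mul, add_zero]
    calc κ * Q⁻¹ = (κ * Q) * Q⁻¹ := by rw [h1]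
      _ = κ := by rw [Matrix.mul_assoc, hQQ, Matrix.mul_one]
  have hGX : G * X = 1 - ι * κ := by
    have h1 : G * (T + D) = Q - ι * κ := by rw [Matrix.mul_add, hGT, hQ]; abel
    rw [hX, ← Matrix.mul_assoc, h1, Matrix.sub_mul, hQQ, Matrix.mul_assoc, hκQ]
  have hGXι : G * (X * ι) = 0 := by
    rw [← Matrix.mul_assoc, hGX, Matrix.sub_mul, Matrix.one_mul, Matrix.mul_assoc, hκι,
      Matrix.mul_one, sub_self]
  have hrι : ι.rank = Fintype.card k := by
    apply le_antisymm (rank_le_card_width ι)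
    have := rank_mul_le_right κ ι
    rwa [hκι, rank_one] at this
  have hker : LinearMap.ker X.mulVecLin ≤ LinearMap.range ι.mulVecLin := by
    intro v hv
    have hv' : X *ᵥ v = 0 := hv
    have h1 : (1 - ι * κ) *ᵥ v = 0 := by rw [← hGX, ← mulVec_mulVec, hv', mulVec_zero]
    rw [sub_mulVec, one_mulVec, sub_eq_zero, ← mulVec_mulVec] at h1
    exact ⟨κ *ᵥ v, h1.symm⟩
  have hrk : X.rank + Module.finrank ℂ (LinearMap.ker X.mulVecLin) = Fintype.card n := by
    have := X.mulVecLin.finrank_range_add_finrank_ker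
    simpa [Matrix.rank] using this
  have hle := Submodule.finrank_mono hker
  have hrι' : Module.finrank ℂ (LinearMap.range ι.mulVecLin) = Fintype.card k := hrι
  have hXι : X.rank + Fintype.card k = Fintype.card n ↔ X * ι = 0 := by
    constructor
    · intro h
      have heq : LinearMap.ker X.mulVecLin = LinearMap.range ι.mulVecLin :=
        Submodule.eq_of_le_of_finrank_le hker (by omega)
      apply Matrix.ext_of_mulVec_single
      intro i
      have : ι *ᵥ Pi.single i 1 ∈ LinearMap.ker X.mulVecLin := heq ▸ ⟨_, rfl⟩
      rw [← mulVec_mulVec, zero_mulVec]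
      exact this
    · intro h
      have := rank_add_rank_le_card_of_mul_eq_zero h
      omega
  have hπX : π * (X * ι) = π * (D * (Q⁻¹ * ι)) := by
    rw [hX, Matrix.mul_assoc, Matrix.add_mul, Matrix.mul_add, ← Matrix.mul_assoc π T, hπT,
      Matrix.zero_mul, zero_add]
  have hπ : X * ι = 0 ↔ schurComplement π G ι D = 0 := by
    have hinv : Q.det • (π * (X * ι)) = schurComplement π G ι D := by
      rw [hπX, Matrix.inv_def, Ring.inverse_eq_inv']
      simp only [Matrix.smul_mul, Matrix.mul_smul, smul_smul, mul_inv_cancel₀ hdet, one_smul]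
      rfl
    rw [← hinv, smul_eq_zero_iff_right hdet]
    constructor
    · intro h; rw [h, Matrix.mul_zero]
    · intro h
      have h1 : T * (G * (X * ι)) = X * ι - j * (π * (X * ι)) := by
        rw [← Matrix.mul_assoc, hTG, Matrix.sub_mul, Matrix.one_mul, Matrix.mul_assoc j]
      rw [hGXι, h, Matrix.mul_zero, Matrix.mul_zero, sub_zero] at h1
      exact h1.symm
  rw [← hrank]
  exact ⟨by omega, hXι.trans hπ⟩

/-- This cuts the number of real equations for a `k`-fold eigenvalue from `2 k ^ 2` to `k ^ 2`. The
reason is that `D` can be moved through: `adjugate (1 + D * G) * D = D * adjugate (1 + G * D)`. -/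
theorem isHermitian_schurComplement {k : Type*} {G D : Matrix n n ℂ} (ι : Matrix n k ℂ)
    (hG : Gᴴ = G) (hD : Dᴴ = D) (hdet : (1 + G * D).det ≠ 0) :
    (schurComplement ιᴴ G ι D)ᴴ = schurComplement ιᴴ G ι D := by
  have hdet' : (1 + D * G).det = (1 + G * D).det := det_one_add_mul_comm D G
  have key : adjugate (1 + D * G) * D = D * adjugate (1 + G * D) := by
    have h1 : (1 + D * G) * D = D * (1 + G * D) := by
      rw [Matrix.add_mul, Matrix.mul_add, Matrix.one_mul, Matrix.mul_one, Matrix.mul_assoc]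
    have h2 : adjugate (1 + D * G) * ((1 + D * G) * D) * adjugate (1 + G * D)
        = adjugate (1 + D * G) * (D * (1 + G * D)) * adjugate (1 + G * D) := by rw [h1]
    rw [← Matrix.mul_assoc, adjugate_mul, Matrix.mul_assoc, Matrix.mul_assoc, Matrix.mul_assoc,
      mul_adjugate, hdet', Matrix.smul_mul, Matrix.one_mul, Matrix.mul_smul, Matrix.mul_one,
      Matrix.mul_smul] at h2
    exact (smul_right_injective _ hdet h2).symm
  have h3 : (adjugate (1 + G * D))ᴴ = adjugate (1 + D * G) := by
    rw [adjugate_conjTranspose]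
    simp [conjTranspose_add, conjTranspose_mul, hG, hD]
  unfold schurComplement
  rw [conjTranspose_mul, conjTranspose_mul, conjTranspose_mul, h3, hD, conjTranspose_conjTranspose,
    Matrix.mul_assoc, Matrix.mul_assoc, ← Matrix.mul_assoc _ D, key, Matrix.mul_assoc]

end SchurComplement

/-! ### Eigenspaces and pseudoinverses of a diagonalized Hermitian matrix. -/

section Spectral

open Matrix

variable {n : ℕ}

/-- The columns of `V` with `d j = μ`. -/
noncomputable def eigenColumns (V : Matrix (Fin n) (Fin n) ℂ) (d : Fin n → ℝ) (μ : ℝ) :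
    Matrix (Fin n) {j // d j = μ} ℂ :=
  V.submatrix id Subtype.val

/-- The pseudoinverse of `V * diagonal d * Vᴴ - μ`, for unitary `V`. -/
noncomputable def shiftedPinv (V : Matrix (Fin n) (Fin n) ℂ) (d : Fin n → ℝ) (μ : ℝ) :
    Matrix (Fin n) (Fin n) ℂ :=
  V * diagonal (fun j => (((d j - μ)⁻¹ : ℝ) : ℂ)) * Vᴴ

variable {V : Matrix (Fin n) (Fin n) ℂ} {d : Fin n → ℝ} {H : Matrix (Fin n) (Fin n) ℂ}

theorem eigenColumns_conjTranspose_mul_self (hV : Vᴴ * V = 1) (μ : ℝ) :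
    (eigenColumns V d μ)ᴴ * eigenColumns V d μ = 1 := by
  ext a b
  have := congrFun (congrFun hV a.1) b.1
  simpa [eigenColumns, Matrix.mul_apply, Matrix.one_apply, Subtype.ext_iff] using this

theorem eigenColumns_conjTranspose_mul_of_ne (hV : Vᴴ * V = 1) {μ ν : ℝ} (h : μ ≠ ν) :
    (eigenColumns V d μ)ᴴ * eigenColumns V d ν = 0 := by
  ext a b
  have := congrFun (congrFun hV a.1) b.1
  have hab : a.1 ≠ b.1 := fun e => h (by rw [← a.2, e, b.2])
  simpa [eigenColumns, Matrix.mul_apply, Matrix.one_apply, hab] using this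

theorem eigenColumns_mul_conjTranspose (μ : ℝ) :
    eigenColumns V d μ * (eigenColumns V d μ)ᴴ
      = V * diagonal (fun j => if d j = μ then 1 else 0) * Vᴴ := by
  ext a b
  rw [Matrix.mul_apply, Matrix.mul_apply]
  simp only [Matrix.mul_diagonal, mul_ite, mul_one, mul_zero, ite_mul, zero_mul]
  rw [← Finset.sum_filter]
  exact (Finset.sum_subtype (p := fun j => d j = μ) (Finset.univ.filter fun j => d j = μ)
    (by simp) (fun j => V a j * Vᴴ j b)).symm

theorem shiftedPinv_conjTranspose (μ : ℝ) : (shiftedPinv V d μ)ᴴ = shiftedPinv V d μ := by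
  simp only [shiftedPinv, conjTranspose_mul, conjTranspose_conjTranspose,
    diagonal_conjTranspose, Matrix.mul_assoc]
  congr 3
  funext j
  simp

theorem sub_smul_one_eq (hV' : V * Vᴴ = 1)
    (hH : H = V * diagonal (fun j => ((d j : ℝ) : ℂ)) * Vᴴ) (μ : ℝ) :
    H - (μ : ℂ) • (1 : Matrix (Fin n) (Fin n) ℂ)
      = V * diagonal (fun j => ((d j - μ : ℝ) : ℂ)) * Vᴴ := by
  have : (fun j => ((d j - μ : ℝ) : ℂ)) = fun j => ((d j : ℝ) : ℂ) - (μ : ℂ) := by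
    funext j; simp
  rw [this, ← diagonal_sub (fun j => ((d j : ℝ) : ℂ)) (fun _ => (μ : ℂ)), Matrix.mul_sub, Matrix.sub_mul, ← hH]
  congr 1
  rw [← smul_one_eq_diagonal, Matrix.mul_smul, Matrix.smul_mul, Matrix.mul_one, hV']

theorem conj_diagonal_mul (hV : Vᴴ * V = 1) (x y : Fin n → ℂ) :
    (V * diagonal x * Vᴴ) * (V * diagonal y * Vᴴ) = V * diagonal (x * y) * Vᴴ := by
  have : (V * diagonal x * Vᴴ) * (V * diagonal y * Vᴴ)
      = V * diagonal x * ((Vᴴ * V) * (diagonal y * Vᴴ)) := by simp only [Matrix.mul_assoc]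
  rw [this, hV, Matrix.one_mul, ← Matrix.mul_assoc, Matrix.mul_assoc V, diagonal_mul_diagonal]
  rfl

theorem shiftedPinv_mul (hV : Vᴴ * V = 1) (hV' : V * Vᴴ = 1)
    (hH : H = V * diagonal (fun j => ((d j : ℝ) : ℂ)) * Vᴴ) (μ : ℝ) :
    shiftedPinv V d μ * (H - (μ : ℂ) • (1 : Matrix (Fin n) (Fin n) ℂ))
      = 1 - eigenColumns V d μ * (eigenColumns V d μ)ᴴ := by
  have h1 : (1 : Matrix (Fin n) (Fin n) ℂ) = V * diagonal 1 * Vᴴ := by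
    simp [hV']
  rw [sub_smul_one_eq hV' hH, shiftedPinv, conj_diagonal_mul hV, eigenColumns_mul_conjTranspose, h1,
    ← Matrix.sub_mul, ← Matrix.mul_sub, diagonal_sub]
  congr 3
  funext j
  -- On the eigenspace of `μ` the convention `0⁻¹ = 0` is what makes this the pseudoinverse.
  by_cases h : d j = μ
  · simp [h]
  · have : ((d j - μ : ℝ) : ℂ) ≠ 0 := by exact_mod_cast sub_ne_zero.mpr h
    simp only [Pi.mul_apply, Pi.one_apply, h, if_false, sub_zero]
    push_cast at this ⊢
    exact inv_mul_cancel₀ this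

theorem mul_shiftedPinv (hV : Vᴴ * V = 1) (hV' : V * Vᴴ = 1)
    (hH : H = V * diagonal (fun j => ((d j : ℝ) : ℂ)) * Vᴴ) (μ : ℝ) :
    (H - (μ : ℂ) • (1 : Matrix (Fin n) (Fin n) ℂ)) * shiftedPinv V d μ
      = 1 - eigenColumns V d μ * (eigenColumns V d μ)ᴴ := by
  rw [← shiftedPinv_mul hV hV' hH, sub_smul_one_eq hV' hH, shiftedPinv, conj_diagonal_mul hV,
    conj_diagonal_mul hV, mul_comm]

theorem conjTranspose_eigenColumns_mul_conj (hV : Vᴴ * V = 1) (μ : ℝ) (x : Fin n → ℂ)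
    (hx : ∀ j, d j = μ → x j = 0) :
    (eigenColumns V d μ)ᴴ * (V * diagonal x * Vᴴ) = 0 := by
  have h : (eigenColumns V d μ)ᴴ * V * diagonal x = 0 := by
    ext a b
    have := congrFun (congrFun hV a.1) b
    rw [Matrix.mul_diagonal]
    by_cases hab : a.1 = b
    · rw [hx b (hab ▸ a.2), mul_zero]; rfl
    · simp only [Matrix.one_apply, hab, if_false] at this
      have h2 : ((eigenColumns V d μ)ᴴ * V) a b = 0 := by
        rw [← this]; simp [eigenColumns, Matrix.mul_apply]
      rw [h2, zero_mul]; rfl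
  rw [← Matrix.mul_assoc, ← Matrix.mul_assoc, h, Matrix.zero_mul]

theorem conjTranspose_eigenColumns_mul_shiftedPinv (hV : Vᴴ * V = 1) (μ : ℝ) :
    (eigenColumns V d μ)ᴴ * shiftedPinv V d μ = 0 :=
  conjTranspose_eigenColumns_mul_conj hV μ _ fun j hj => by simp [hj]

theorem conjTranspose_eigenColumns_mul_sub (hV : Vᴴ * V = 1) (hV' : V * Vᴴ = 1)
    (hH : H = V * diagonal (fun j => ((d j : ℝ) : ℂ)) * Vᴴ) (μ : ℝ) :
    (eigenColumns V d μ)ᴴ * (H - (μ : ℂ) • (1 : Matrix (Fin n) (Fin n) ℂ)) = 0 := by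
  rw [sub_smul_one_eq hV' hH]
  exact conjTranspose_eigenColumns_mul_conj hV μ _ fun j hj => by simp [hj]

theorem mul_eigenColumns (hV : Vᴴ * V = 1) (hV' : V * Vᴴ = 1)
    (hH : H = V * diagonal (fun j => ((d j : ℝ) : ℂ)) * Vᴴ) (μ : ℝ) :
    H * eigenColumns V d μ = (μ : ℂ) • eigenColumns V d μ := by
  have hHs : Hᴴ = H := by
    rw [hH]
    simp only [conjTranspose_mul, conjTranspose_conjTranspose,
      diagonal_conjTranspose, Matrix.mul_assoc]
    congr 3
    funext j
    simp
  have h := congrArg conjTranspose (conjTranspose_eigenColumns_mul_sub hV hV' hH μ)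
  rw [conjTranspose_mul, conjTranspose_conjTranspose, conjTranspose_sub, hHs, conjTranspose_smul,
    conjTranspose_one, conjTranspose_zero, Matrix.sub_mul, Matrix.smul_mul, Matrix.one_mul,
    sub_eq_zero] at h
  simpa using h

theorem rank_sub_smul_one_add_card (hV : Vᴴ * V = 1) (hV' : V * Vᴴ = 1)
    (hH : H = V * diagonal (fun j => ((d j : ℝ) : ℂ)) * Vᴴ) (μ : ℝ) :
    (H - (μ : ℂ) • (1 : Matrix (Fin n) (Fin n) ℂ)).rank + Fintype.card {j // d j = μ} = n := by
  have := (rank_add_schurComplement (D := 0) (shiftedPinv_mul hV hV' hH μ)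
    (mul_shiftedPinv hV hV' hH μ) (conjTranspose_eigenColumns_mul_shiftedPinv hV μ)
    (eigenColumns_conjTranspose_mul_self hV μ)
    (conjTranspose_eigenColumns_mul_sub hV hV' hH μ) (by simp)).2.mpr
      (by simp [schurComplement])
  simpa using this

end Spectral

/-! ### Squared singular values as the eigenvalues of `Aᴴ * A`. -/

section SingularValues

open Matrix

variable {m n : ℕ}

theorem exists_unitary_conjTranspose_mul_self (A : Matrix (Fin m) (Fin n) ℂ) :
    ∃ V : Matrix (Fin n) (Fin n) ℂ, Vᴴ * V = 1 ∧ V * Vᴴ = 1 ∧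
      Aᴴ * A = V * diagonal (fun j : Fin n => ((matrixSingularValue A j ^ 2 : ℝ) : ℂ)) * Vᴴ := by
  set T := Matrix.toEuclideanLin A with hT
  have hn : Module.finrank ℂ (EuclideanSpace ℂ (Fin n)) = n := by simp
  let b := T.isSymmetric_adjoint_comp_self.eigenvectorBasis hn
  let V : Matrix (Fin n) (Fin n) ℂ := Matrix.of fun i j => b j i
  have hV : Vᴴ * V = 1 := by
    ext i j
    have := orthonormal_iff_ite.mp b.orthonormal i j
    rw [Matrix.one_apply, ← this]
    simp [V, Matrix.mul_apply, PiLp.inner_apply, mul_comm]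
  have hV' : V * Vᴴ = 1 := mul_eq_one_comm.mp hV
  refine ⟨V, hV, hV', ?_⟩
  have key : Aᴴ * A * V = V * diagonal (fun j : Fin n => ((matrixSingularValue A j ^ 2 : ℝ) : ℂ)) := by
    ext i j
    have h := T.isSymmetric_adjoint_comp_self.apply_eigenvectorBasis hn j
    rw [← T.sq_singularValues_fin hn j] at h
    have h0 : Matrix.toEuclideanLin Aᴴ (Matrix.toEuclideanLin A (b j))
        = ((T.singularValues j ^ 2 : ℝ) : ℂ) • b j := by
      rw [Matrix.toEuclideanLin_conjTranspose_eq_adjoint]; exact h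
    have h2 := congrArg (fun v : EuclideanSpace ℂ (Fin n) => v i) h0
    rw [Matrix.mul_diagonal, Matrix.mul_assoc]
    have h3 : (Aᴴ * (A * V)) i j = (Aᴴ *ᵥ (A *ᵥ fun a => b j a)) i := by
      rw [mulVec_mulVec, ← Matrix.mul_assoc]; rfl
    rw [h3]
    rw [mul_comm]
    exact h2
  rw [← key, Matrix.mul_assoc, hV', Matrix.mul_one]

end SingularValues

/-! ### The real dimension of the Hermitian matrices. -/

section SelfAdjointDimension

open Matrix

variable {k : Type*} [Fintype k]

instance finiteDimensional_selfAdjoint_matrix :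
    FiniteDimensional ℝ (selfAdjoint (Matrix k k ℂ)) :=
  FiniteDimensional.of_injective (V₂ := Matrix k k ℂ)
    { toFun := Subtype.val, map_add' := fun _ _ => rfl, map_smul' := fun _ _ => rfl }
    Subtype.val_injective

theorem finrank_real_matrix (m n : Type*) [Fintype m] [Fintype n] :
    Module.finrank ℝ (Matrix m n ℂ) = 2 * (Fintype.card m * Fintype.card n) := by
  rw [← Module.finrank_mul_finrank ℝ ℂ, Complex.finrank_real_complex, Module.finrank_matrix]
  simp

/-- Multiplication by `±i` exchanges Hermitian and skew-Hermitian matrices, so each has half of the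
real dimension `2 k ^ 2`. -/
theorem finrank_selfAdjoint_matrix :
    Module.finrank ℝ (selfAdjoint (Matrix k k ℂ)) = Fintype.card k ^ 2 := by
  have h1 := (StarModule.decomposeProdAdjoint ℝ (Matrix k k ℂ)).finrank_eq
  have : FiniteDimensional ℝ (skewAdjoint (Matrix k k ℂ)) :=
    FiniteDimensional.of_injective (V₂ := Matrix k k ℂ)
      { toFun := Subtype.val, map_add' := fun _ _ => rfl, map_smul' := fun _ _ => rfl }
      Subtype.val_injective
  rw [Module.finrank_prod, finrank_real_matrix] at h1
  have h2 : Module.finrank ℝ (skewAdjoint (Matrix k k ℂ))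
      ≤ Module.finrank ℝ (selfAdjoint (Matrix k k ℂ)) := by
    apply LinearMap.finrank_le_finrank_of_injective (f := skewAdjoint.negISMul)
    intro x y hxy
    have h := congrArg Subtype.val hxy
    simp only [skewAdjoint.negISMul_apply_coe] at h
    exact Subtype.ext (smul_right_injective _ (by simp) h)
  have h3 : Module.finrank ℝ (selfAdjoint (Matrix k k ℂ))
      ≤ Module.finrank ℝ (skewAdjoint (Matrix k k ℂ)) := by
    let g : selfAdjoint (Matrix k k ℂ) →ₗ[ℝ] skewAdjoint (Matrix k k ℂ) :=
      { toFun := fun x => ⟨Complex.I • x.1, by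
          rw [skewAdjoint.mem_iff, star_smul, selfAdjoint.mem_iff.mp x.2]; simp⟩
        map_add' := fun x y => Subtype.ext (smul_add _ _ _)
        map_smul' := fun r x => Subtype.ext (smul_comm _ _ _) }
    apply LinearMap.finrank_le_finrank_of_injective (f := g)
    intro x y hxy
    exact Subtype.ext (smul_right_injective _ Complex.I_ne_zero (congrArg Subtype.val hxy))
  nlinarith

end SelfAdjointDimension

/-! ### Smoothness and derivatives of matrix expressions. -/

section MatrixCalculus

open Matrix

variable {m n k l : Type*} [Fintype m] [Fintype n] [Fintype k] [Fintype l]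
  {E : Type*} [NormedAddCommGroup E] [NormedSpace ℝ E] {r : WithTop ℕ∞}

theorem contDiff_matrix {f : E → Matrix m n ℂ} :
    ContDiff ℝ r f ↔ ∀ i j, ContDiff ℝ r fun x => f x i j := by
  have h1 : ContDiff ℝ r f ↔ ∀ i, ContDiff ℝ r fun x => f x i := contDiff_pi
  rw [h1]
  exact forall_congr' fun i => contDiff_pi

theorem ContDiff.matrix_mul {f : E → Matrix m n ℂ} {g : E → Matrix n k ℂ}
    (hf : ContDiff ℝ r f) (hg : ContDiff ℝ r g) : ContDiff ℝ r fun x => f x * g x := by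
  rw [contDiff_matrix] at *
  intro i j
  simp only [Matrix.mul_apply]
  exact ContDiff.sum fun a _ => (hf i a).mul (hg a j)

theorem ContDiff.matrix_conjTranspose {f : E → Matrix m n ℂ}
    (hf : ContDiff ℝ r f) : ContDiff ℝ r fun x => (f x)ᴴ := by
  rw [contDiff_matrix] at *
  intro i j
  exact Complex.conjCLE.contDiff.comp (hf j i)

theorem ContDiff.matrix_det [DecidableEq n] {f : E → Matrix n n ℂ}
    (hf : ContDiff ℝ r f) : ContDiff ℝ r fun x => (f x).det := by
  rw [contDiff_matrix] at hf
  simp only [Matrix.det_apply']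
  exact ContDiff.sum fun σ _ => contDiff_const.mul (contDiff_prod fun i _ => hf _ _)

theorem ContDiff.matrix_adjugate [DecidableEq n] {f : E → Matrix n n ℂ}
    (hf : ContDiff ℝ r f) : ContDiff ℝ r fun x => (f x).adjugate := by
  rw [contDiff_matrix]
  intro i j
  simp only [Matrix.adjugate_apply]
  apply ContDiff.matrix_det
  rw [contDiff_matrix] at *
  intro a b
  by_cases h : a = j
  · subst h; simpa using contDiff_const
  · simpa [Matrix.updateRow_apply, h] using hf a b

theorem ContDiff.schurComplement [DecidableEq n] {π : Matrix l m ℂ}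
    {G : Matrix n m ℂ} {ι : Matrix n k ℂ} {D : E → Matrix m n ℂ} (hD : ContDiff ℝ r D) :
    ContDiff ℝ r fun x => schurComplement π G ι (D x) :=
  contDiff_const.matrix_mul (hD.matrix_mul
    (((contDiff_const.add (contDiff_const.matrix_mul hD)).matrix_adjugate).matrix_mul
      contDiff_const))

variable (m n k) in
/-- Matrix multiplication as a continuous bilinear map. -/
noncomputable def matrixMulBilin : Matrix m n ℂ →L[ℝ] Matrix n k ℂ →L[ℝ] Matrix m k ℂ :=
  LinearMap.toContinuousBilinearMap
    (LinearMap.mk₂ ℝ (fun A B => A * B) Matrix.add_mul (fun c A B => Matrix.smul_mul c A B)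
      Matrix.mul_add (fun c A B => Matrix.mul_smul A c B))

theorem HasFDerivAt.matrix_mul {f : E → Matrix m n ℂ} {g : E → Matrix n k ℂ}
    {f' : E →L[ℝ] Matrix m n ℂ} {g' : E →L[ℝ] Matrix n k ℂ} {x : E}
    (hf : HasFDerivAt f f' x) (hg : HasFDerivAt g g' x) :
    ∃ L : E →L[ℝ] Matrix m k ℂ, HasFDerivAt (fun y => f y * g y) L x ∧
      ∀ v, L v = f x * g' v + f' v * g x :=
  ⟨_, (matrixMulBilin m n k).hasFDerivAt_of_bilinear hf hg, fun _ => rfl⟩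

theorem HasFDerivAt.matrix_conjTranspose {f : E → Matrix m n ℂ}
    {f' : E →L[ℝ] Matrix m n ℂ} {x : E} (hf : HasFDerivAt f f' x) :
    ∃ L : E →L[ℝ] Matrix n m ℂ, HasFDerivAt (fun y => (f y)ᴴ) L x ∧ ∀ v, L v = (f' v)ᴴ :=
  ⟨_, (LinearMap.toContinuousLinearMap
    (Matrix.conjTransposeLinearEquiv m n ℝ ℂ).toLinearMap).hasFDerivAt.comp x hf, fun _ => rfl⟩

/-- Where `D` vanishes the adjugate is `1`, and its variation is multiplied by `D = 0`, so only the
variation of `D` survives. -/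
theorem HasFDerivAt.schurComplement [DecidableEq n] {π : Matrix l m ℂ}
    {G : Matrix n m ℂ} {ι : Matrix n k ℂ} {D : E → Matrix m n ℂ} {D' : E →L[ℝ] Matrix m n ℂ}
    {x : E} (hD : HasFDerivAt D D' x) (hDc : ContDiff ℝ 1 D) (h0 : D x = 0) :
    ∃ L : E →L[ℝ] Matrix l k ℂ, HasFDerivAt (fun y => schurComplement π G ι (D y)) L x ∧
      ∀ v, L v = π * (D' v * ι) := by
  have hB : ContDiff ℝ 1 fun y => adjugate (1 + G * D y) * ι :=
    ((contDiff_const.add (contDiff_const.matrix_mul hDc)).matrix_adjugate).matrix_mul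
      contDiff_const
  obtain ⟨L₁, hL₁, hL₁'⟩ := hD.matrix_mul
    (hB.contDiffAt (x := x) |>.differentiableAt (by simp)).hasFDerivAt
  obtain ⟨L₂, hL₂, hL₂'⟩ := (hasFDerivAt_const π x).matrix_mul hL₁
  refine ⟨L₂, hL₂, fun v => ?_⟩
  rw [hL₂', hL₁', h0]
  simp

end MatrixCalculus

/-! ### Strata, multiplicities and semicontinuity of the spectrum. -/

section Strata

open Matrix
open scoped ComplexOrder

variable {m n : ℕ}

/-- The distinct nonzero eigenvalues of `Aᴴ * A`. -/
noncomputable def posSpectrum (A : Matrix (Fin m) (Fin n) ℂ) : Finset ℝ :=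
  (Finset.univ.image fun j : Fin n => matrixSingularValue A j ^ 2).erase 0

/-- The multiplicity of `μ` as an eigenvalue of `Aᴴ * A`. -/
noncomputable def eigenMult (A : Matrix (Fin m) (Fin n) ℂ) (μ : ℝ) : ℕ :=
  Fintype.card {j : Fin n // matrixSingularValue A j ^ 2 = μ}

/-- The matrices of rank `ρ` with `r` distinct positive singular values, whose multiplicities
have square sum `c`. -/
def singularStratum (m n ρ r c : ℕ) : Set (Matrix (Fin m) (Fin n) ℂ) :=
  {A | A.rank = ρ ∧ (posSpectrum A).card = r ∧ ∑ μ ∈ posSpectrum A, eigenMult A μ ^ 2 = c}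

variable {A : Matrix (Fin m) (Fin n) ℂ} {μ : ℝ}

theorem pos_of_mem_posSpectrum (h : μ ∈ posSpectrum A) : 0 < μ := by
  simp only [posSpectrum, Finset.mem_erase, Finset.mem_image, Finset.mem_univ, true_and] at h
  obtain ⟨h0, j, rfl⟩ := h
  exact lt_of_le_of_ne (sq_nonneg _) (Ne.symm h0)

theorem eigenMult_pos_iff : 0 < eigenMult A μ ↔ ∃ j : Fin n, matrixSingularValue A j ^ 2 = μ := by
  simp [eigenMult, Fintype.card_pos_iff]

theorem mem_posSpectrum_iff : μ ∈ posSpectrum A ↔ μ ≠ 0 ∧ 0 < eigenMult A μ := by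
  simp [eigenMult_pos_iff, posSpectrum]

theorem rank_sub_add_eigenMult (A : Matrix (Fin m) (Fin n) ℂ) (μ : ℝ) :
    (Aᴴ * A - (μ : ℂ) • (1 : Matrix (Fin n) (Fin n) ℂ)).rank + eigenMult A μ = n := by
  obtain ⟨V, hV, hV', hH⟩ := exists_unitary_conjTranspose_mul_self A
  exact rank_sub_smul_one_add_card hV hV' hH μ

theorem rank_add_eigenMult_zero (A : Matrix (Fin m) (Fin n) ℂ) : A.rank + eigenMult A 0 = n := by
  have := rank_sub_add_eigenMult A 0
  rwa [Complex.ofReal_zero, zero_smul, sub_zero, rank_conjTranspose_mul_self] at this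

/-- The multiplicities are determined by any unitary diagonalization. -/
theorem eigenMult_eq_card {V : Matrix (Fin n) (Fin n) ℂ} {d : Fin n → ℝ} (hV : Vᴴ * V = 1)
    (hH : Aᴴ * A = V * diagonal (fun j => ((d j : ℝ) : ℂ)) * Vᴴ) (μ : ℝ) :
    eigenMult A μ = Fintype.card {j // d j = μ} := by
  have h1 := rank_sub_smul_one_add_card hV (mul_eq_one_comm.mp hV) hH μ
  have h2 := rank_sub_add_eigenMult A μ
  omega

theorem sum_eigenMult (A : Matrix (Fin m) (Fin n) ℂ) :
    ∑ μ ∈ posSpectrum A, eigenMult A μ = A.rank := by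
  set I := Finset.univ.image fun j : Fin n => matrixSingularValue A j ^ 2 with hI
  have h1 : n = ∑ μ ∈ I, eigenMult A μ := by
    have := Finset.card_eq_sum_card_image (fun j : Fin n => matrixSingularValue A j ^ 2)
      Finset.univ
    rw [Finset.card_univ, Fintype.card_fin] at this
    refine this.trans (Finset.sum_congr rfl fun μ _ => ?_)
    rw [eigenMult, Fintype.card_subtype]
  have h2 := rank_add_eigenMult_zero A
  have h3 : ∑ μ ∈ posSpectrum A, eigenMult A μ + eigenMult A 0 = ∑ μ ∈ I, eigenMult A μ := by
    by_cases h0 : (0 : ℝ) ∈ I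
    · exact Finset.sum_erase_add _ _ h0
    · have h4 : eigenMult A 0 = 0 := by
        by_contra h
        obtain ⟨j, hj⟩ := eigenMult_pos_iff.mp (Nat.pos_of_ne_zero h)
        exact h0 (Finset.mem_image.mpr ⟨j, Finset.mem_univ _, hj⟩)
      rw [posSpectrum, ← hI, Finset.erase_eq_of_notMem h0, h4, add_zero]
  omega

theorem card_posSpectrum_le_rank (A : Matrix (Fin m) (Fin n) ℂ) :
    (posSpectrum A).card ≤ A.rank := by
  rw [← sum_eigenMult, Finset.card_eq_sum_ones]
  exact Finset.sum_le_sum fun μ hμ => (mem_posSpectrum_iff.mp hμ).2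

/-- Eigenvalues of `Aᴴ * A` persist under small perturbations of `A`. -/
theorem eventually_exists_eigenvalue_near {A₀ : Matrix (Fin m) (Fin n) ℂ}
    (hμ : 0 < eigenMult A₀ μ) {ε : ℝ} (hε : 0 < ε) :
    ∀ᶠ A in 𝓝 A₀, ∃ j : Fin n, |matrixSingularValue A j ^ 2 - μ| < ε := by
  obtain ⟨V₀, hV₀, hV₀', hH₀⟩ := exists_unitary_conjTranspose_mul_self A₀
  obtain ⟨j₀, hj₀⟩ := eigenMult_pos_iff.mp hμ
  let M : Matrix (Fin m) (Fin n) ℂ → Matrix (Fin n) (Fin n) ℂ := fun A =>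
    Aᴴ * A - (μ : ℂ) • (1 : Matrix (Fin n) (Fin n) ℂ)
  let v : Fin n → ℂ := fun i => V₀ i j₀
  have hMv : M A₀ *ᵥ v = 0 := by
    have h1 := mul_eigenColumns hV₀ hV₀' hH₀ μ
    funext i
    have h2 := congrFun (congrFun h1 i) ⟨j₀, hj₀⟩
    have h3 : ((A₀ᴴ * A₀) *ᵥ v) i = (μ : ℂ) * v i := h2
    simp only [M, sub_mulVec, smul_mulVec, one_mulVec, Pi.sub_apply, h3, Pi.smul_apply,
      smul_eq_mul, sub_self, Pi.zero_apply]
  have hvv : star v ⬝ᵥ v = 1 := by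
    have := congrFun (congrFun hV₀ j₀) j₀
    rw [Matrix.one_apply_eq] at this
    exact this
  -- If every eigenvalue of `Aᴴ * A` were at distance at least `ε` from `μ`, then `M A * M A - ε ^
  -- 2` would be positive semidefinite and `q A ≥ ε ^ 2` for the unit vector `v`. But `q` is
  -- continuous and vanishes at `A₀`.
  let q : Matrix (Fin m) (Fin n) ℂ → ℝ := fun A => (star v ⬝ᵥ (M A * M A) *ᵥ v).re
  have hMc : ContDiff ℝ 0 M :=
    (contDiff_id.matrix_conjTranspose.matrix_mul contDiff_id).sub contDiff_const
  have hqc : Continuous q := by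
    have h1 : Continuous fun A => M A * M A := (hMc.matrix_mul hMc).continuous
    exact Complex.continuous_re.comp (continuous_const.dotProduct (h1.matrix_mulVec continuous_const))
  have hq0 : q A₀ = 0 := by
    simp only [q]
    rw [← mulVec_mulVec, hMv, mulVec_zero, dotProduct_zero, Complex.zero_re]
  have hev : ∀ᶠ A in 𝓝 A₀, q A < ε ^ 2 :=
    hqc.continuousAt.eventually_lt_const (by rw [hq0]; positivity)
  filter_upwards [hev] with A hA
  by_contra! hcon
  obtain ⟨V, hV, hV', hH⟩ := exists_unitary_conjTranspose_mul_self A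
  have hMM : M A * M A - ((ε ^ 2 : ℝ) : ℂ) • (1 : Matrix (Fin n) (Fin n) ℂ)
      = V * diagonal (fun j : Fin n =>
        (((matrixSingularValue A j ^ 2 - μ) * (matrixSingularValue A j ^ 2 - μ) - ε ^ 2 : ℝ) : ℂ))
        * Vᴴ := by
    refine sub_smul_one_eq (d := fun j : Fin n =>
      (matrixSingularValue A j ^ 2 - μ) * (matrixSingularValue A j ^ 2 - μ)) hV' ?_ (ε ^ 2)
    simp only [M]
    rw [sub_smul_one_eq hV' hH, conj_diagonal_mul hV]
    congr 3
    funext j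
    simp
  have hps : (M A * M A - ((ε ^ 2 : ℝ) : ℂ) • (1 : Matrix (Fin n) (Fin n) ℂ)).PosSemidef := by
    rw [hMM]
    apply PosSemidef.mul_mul_conjTranspose_same
    rw [posSemidef_diagonal_iff]
    intro j
    have h1 : ε ^ 2 ≤ |matrixSingularValue A j ^ 2 - μ| ^ 2 :=
      pow_le_pow_left₀ hε.le (hcon j) 2
    rw [sq_abs] at h1
    exact_mod_cast (by nlinarith : 0 ≤ (matrixSingularValue A j ^ 2 - μ)
      * (matrixSingularValue A j ^ 2 - μ) - ε ^ 2)
  have h2 := hps.dotProduct_mulVec_nonneg v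
  rw [sub_mulVec, smul_mulVec, one_mulVec, dotProduct_sub, dotProduct_smul, hvv] at h2
  have h3 := (Complex.le_def.mp h2).1
  simp only [Complex.zero_re, Complex.sub_re, smul_eq_mul, mul_one, Complex.ofReal_re] at h3
  have h4 : (star v ⬝ᵥ (M A * M A) *ᵥ v).re < ε ^ 2 := hA
  linarith

/-- Small perturbations of `A₀` have eigenvalues near each positive eigenvalue of `A₀ᴴ * A₀`. -/
theorem eventually_exists_posSpectrum_near (A₀ : Matrix (Fin m) (Fin n) ℂ) {ε : ℝ} (hε : 0 < ε)
    (hpos : ∀ μ ∈ posSpectrum A₀, ε < μ) :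
    ∀ᶠ A in 𝓝 A₀, ∀ μ ∈ posSpectrum A₀, ∃ ν ∈ posSpectrum A, |ν - μ| < ε := by
  rw [eventually_all_finset]
  intro μ hμ
  filter_upwards [eventually_exists_eigenvalue_near (mem_posSpectrum_iff.mp hμ).2 hε] with A hA
  obtain ⟨j, hj⟩ := hA
  refine ⟨_, mem_posSpectrum_iff.mpr ⟨?_, eigenMult_pos_iff.mpr ⟨j, rfl⟩⟩, hj⟩
  intro h0
  rw [h0, zero_sub, abs_neg] at hj
  exact absurd (hpos μ hμ) (not_lt.mpr ((le_abs_self _).trans hj.le))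

/-- A finite set of positive reals is separated, and bounded away from `0`. -/
theorem eventually_separated (s : Finset ℝ) (hs : ∀ μ ∈ s, 0 < μ) :
    ∀ᶠ ε in 𝓝[>] (0 : ℝ), 0 < ε ∧ (∀ μ ∈ s, ε < μ) ∧
      ∀ μ ∈ s, ∀ ν ∈ s, ∀ x : ℝ, |x - μ| < ε → |x - ν| < ε → μ = ν := by
  refine eventually_mem_nhdsWithin.and (Eventually.and ?_ ?_)
  · rw [eventually_all_finset]
    intro μ hμ
    exact (eventually_lt_nhds (hs μ hμ)).filter_mono nhdsWithin_le_nhds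
  · rw [eventually_all_finset]
    intro μ hμ
    rw [eventually_all_finset]
    intro ν hν
    by_cases h : μ = ν
    · exact Eventually.of_forall fun _ _ _ _ => h
    · have h1 : 0 < |μ - ν| / 2 := by
        have := abs_pos.mpr (sub_ne_zero.mpr h); linarith
      filter_upwards [(eventually_lt_nhds h1).filter_mono nhdsWithin_le_nhds] with ε hε x hx hx'
      exfalso
      have h2 : |μ - ν| ≤ |x - μ| + |x - ν| := by
        rw [abs_sub_comm x μ]
        exact (abs_sub_le μ x ν)
      linarith

theorem eventually_card_posSpectrum_le (A₀ : Matrix (Fin m) (Fin n) ℂ) :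
    ∀ᶠ A in 𝓝 A₀, (posSpectrum A₀).card ≤ (posSpectrum A).card := by
  obtain ⟨ε, hε, hpos, hsep⟩ :=
    (eventually_separated (posSpectrum A₀) fun μ => pos_of_mem_posSpectrum).exists
  filter_upwards [eventually_exists_posSpectrum_near A₀ hε hpos] with A hA
  choose! f hf hf' using hA
  refine Finset.card_le_card_of_injOn f hf ?_
  intro μ hμ ν hν hμν
  exact hsep μ hμ ν hν (f μ) (hf' μ hμ) (hμν ▸ hf' ν hν)

end Strata

/-! ### Local equations of a stratum and their derivative. -/

section StratumEquation

open Matrix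
open scoped ComplexOrder

variable {m n : ℕ}

/-- Real linear coordinates on the Hermitian matrices. -/
theorem exists_hermitianCoord (k : Type*) [Fintype k] :
    ∃ h : Matrix k k ℂ →L[ℝ] (Fin (Fintype.card k ^ 2) → ℝ),
      (∀ X : Matrix k k ℂ, Xᴴ = X → (h X = 0 ↔ X = 0)) ∧
      ∀ y, ∃ X : Matrix k k ℂ, Xᴴ = X ∧ h X = y := by
  let e : selfAdjoint (Matrix k k ℂ) ≃ₗ[ℝ] (Fin (Fintype.card k ^ 2) → ℝ) :=
    LinearEquiv.ofFinrankEq _ _ (by rw [finrank_selfAdjoint_matrix, Module.finrank_fin_fun])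
  refine ⟨LinearMap.toContinuousLinearMap (e.toLinearMap ∘ₗ selfAdjointPart ℝ), fun X hX => ?_,
    fun y => ⟨(e.symm y).1, (e.symm y).2, ?_⟩⟩
  · have h := IsSelfAdjoint.coe_selfAdjointPart_apply ℝ (x := X) hX
    change e (selfAdjointPart ℝ X) = 0 ↔ X = 0
    rw [e.map_eq_zero_iff]
    constructor
    · intro h0; rw [← h, h0]; rfl
    · intro h0; rw [h0, map_zero]
  · have h := IsSelfAdjoint.coe_selfAdjointPart_apply ℝ (x := (e.symm y).1) (e.symm y).2
    change e (selfAdjointPart ℝ (e.symm y).1) = y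
    rw [Subtype.ext h, e.apply_symm_apply]

/-- Real linear coordinates on the Hermitian matrices, extended to all matrices. -/
noncomputable def hermitianCoord (k : Type*) [Fintype k] :
    Matrix k k ℂ →L[ℝ] (Fin (Fintype.card k ^ 2) → ℝ) :=
  (exists_hermitianCoord k).choose

theorem hermitianCoord_eq_zero_iff {k : Type*} [Fintype k] {X : Matrix k k ℂ} (hX : Xᴴ = X) :
    hermitianCoord k X = 0 ↔ X = 0 :=
  (exists_hermitianCoord k).choose_spec.1 X hX

theorem exists_hermitianCoord_eq {k : Type*} [Fintype k] (y : Fin (Fintype.card k ^ 2) → ℝ) :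
    ∃ X : Matrix k k ℂ, Xᴴ = X ∧ hermitianCoord k X = y :=
  (exists_hermitianCoord k).choose_spec.2 y

/-- The change of `Aᴴ * A - x` from its value at `(A₀, μ)`. -/
noncomputable def shiftDiff (A₀ : Matrix (Fin m) (Fin n) ℂ) (μ : ℝ)
    (A : Matrix (Fin m) (Fin n) ℂ) (x : ℝ) : Matrix (Fin n) (Fin n) ℂ :=
  Aᴴ * A - (x : ℂ) • 1 - (A₀ᴴ * A₀ - (μ : ℂ) • 1)

theorem shiftDiff_self (A₀ : Matrix (Fin m) (Fin n) ℂ) (μ : ℝ) : shiftDiff A₀ μ A₀ μ = 0 :=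
  sub_self _

theorem shiftDiff_conjTranspose (A₀ : Matrix (Fin m) (Fin n) ℂ) (μ : ℝ)
    (A : Matrix (Fin m) (Fin n) ℂ) (x : ℝ) : (shiftDiff A₀ μ A x)ᴴ = shiftDiff A₀ μ A x := by
  simp [shiftDiff, conjTranspose_sub, conjTranspose_mul, conjTranspose_smul]

theorem contDiff_shiftDiff {s : Finset ℝ} (A₀ : Matrix (Fin m) (Fin n) ℂ) (μ : s)
    {r : WithTop ℕ∞} :
    ContDiff ℝ r fun z : Matrix (Fin m) (Fin n) ℂ × (s → ℝ) => shiftDiff A₀ μ z.1 (z.2 μ) := by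
  have h1 : ContDiff ℝ r fun z : Matrix (Fin m) (Fin n) ℂ × (s → ℝ) => z.1ᴴ * z.1 :=
    contDiff_fst.matrix_conjTranspose.matrix_mul contDiff_fst
  have h2 : ContDiff ℝ r fun z : Matrix (Fin m) (Fin n) ℂ × (s → ℝ) =>
      ((z.2 μ : ℝ) : ℂ) • (1 : Matrix (Fin n) (Fin n) ℂ) := by
    have h3 : ContDiff ℝ r fun z : Matrix (Fin m) (Fin n) ℂ × (s → ℝ) => ((z.2 μ : ℝ) : ℂ) :=
      Complex.ofRealCLM.contDiff.comp ((contDiff_apply ℝ ℝ μ).comp contDiff_snd)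
    rw [contDiff_matrix]
    intro i j
    exact h3.mul contDiff_const
  exact (h1.sub h2).sub contDiff_const

theorem hasFDerivAt_shiftDiff {s : Finset ℝ} (A₀ : Matrix (Fin m) (Fin n) ℂ) (μ : s)
    (p : s → ℝ) :
    ∃ L : Matrix (Fin m) (Fin n) ℂ × (s → ℝ) →L[ℝ] Matrix (Fin n) (Fin n) ℂ,
      HasFDerivAt (fun z : Matrix (Fin m) (Fin n) ℂ × (s → ℝ) => shiftDiff A₀ μ z.1 (z.2 μ)) L
        (A₀, p) ∧
      ∀ v, L v = A₀ᴴ * v.1 + v.1ᴴ * A₀ - ((v.2 μ : ℝ) : ℂ) • 1 := by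
  have hfst : HasFDerivAt (fun z : Matrix (Fin m) (Fin n) ℂ × (s → ℝ) => z.1)
    (ContinuousLinearMap.fst ℝ _ _) (A₀, p) := hasFDerivAt_fst
  obtain ⟨L₁, hL₁, hL₁'⟩ := hfst.matrix_conjTranspose
  obtain ⟨L₂, hL₂, hL₂'⟩ := hL₁.matrix_mul hfst
  let N : Matrix (Fin m) (Fin n) ℂ × (s → ℝ) →L[ℝ] Matrix (Fin n) (Fin n) ℂ :=
    LinearMap.toContinuousLinearMap
      { toFun := fun z => ((z.2 μ : ℝ) : ℂ) • (1 : Matrix (Fin n) (Fin n) ℂ)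
        map_add' := fun z w => by simp [add_smul]
        map_smul' := fun c z => by ext i j; simp [Matrix.smul_apply, mul_assoc] }
  have hN : HasFDerivAt (fun z : Matrix (Fin m) (Fin n) ℂ × (s → ℝ) =>
      ((z.2 μ : ℝ) : ℂ) • (1 : Matrix (Fin n) (Fin n) ℂ)) N (A₀, p) := N.hasFDerivAt
  refine ⟨_, (hL₂.sub hN).sub_const _, fun v => ?_⟩
  change L₂ v - ((v.2 μ : ℝ) : ℂ) • (1 : Matrix (Fin n) (Fin n) ℂ) = _
  rw [hL₂', hL₁']
  rfl

variable (A₀ : Matrix (Fin m) (Fin n) ℂ) (V : Matrix (Fin n) (Fin n) ℂ) (d : Fin n → ℝ)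
  (U : Matrix (Fin m) (Fin m) ℂ) (d' : Fin m → ℝ) (s : Finset ℝ)

/-- The equations satisfied by the matrices `A` near `A₀` of the same rank for which the
parameters are eigenvalues of `Aᴴ * A` with the same multiplicities as the eigenvalues
in `s` of `A₀ᴴ * A₀`. -/
noncomputable def stratumEquation (z : Matrix (Fin m) (Fin n) ℂ × (s → ℝ)) :
    ((μ : s) → Fin (Fintype.card {j // d j = (μ : ℝ)} ^ 2) → ℝ) ×
      Matrix {i // d' i = 0} {j // d j = 0} ℂ :=
  (fun μ => hermitianCoord _ (schurComplement (eigenColumns V d μ)ᴴ (shiftedPinv V d μ)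
      (eigenColumns V d μ) (shiftDiff A₀ μ z.1 (z.2 μ))),
    schurComplement (eigenColumns U d' 0)ᴴ (shiftedPinv V d 0 * A₀ᴴ) (eigenColumns V d 0)
      (z.1 - A₀))

theorem contDiff_stratumEquation {r : WithTop ℕ∞} :
    ContDiff ℝ r (stratumEquation A₀ V d U d' s) := by
  refine ContDiff.prodMk ?_ ?_
  · rw [contDiff_pi]
    intro μ
    exact (hermitianCoord {j // d j = (μ : ℝ)}).contDiff.comp (contDiff_shiftDiff A₀ μ).schurComplement
  · exact (contDiff_fst.sub contDiff_const).schurComplement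

theorem stratumEquation_self :
    stratumEquation A₀ V d U d' s (A₀, fun μ => (μ : ℝ)) = 0 := by
  refine Prod.ext ?_ ?_
  · funext μ
    simp [stratumEquation, shiftDiff_self, schurComplement]
  · simp [stratumEquation, schurComplement]

theorem hasFDerivAt_stratumEquation :
    ∃ L : Matrix (Fin m) (Fin n) ℂ × (s → ℝ) →L[ℝ]
        ((μ : s) → Fin (Fintype.card {j // d j = (μ : ℝ)} ^ 2) → ℝ) ×
        Matrix {i // d' i = 0} {j // d j = 0} ℂ,
      HasFDerivAt (stratumEquation A₀ V d U d' s) L (A₀, fun μ => (μ : ℝ)) ∧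
      (∀ v μ, (L v).1 μ = hermitianCoord _ ((eigenColumns V d μ)ᴴ *
        ((A₀ᴴ * v.1 + v.1ᴴ * A₀ - ((v.2 μ : ℝ) : ℂ) • 1) * eigenColumns V d μ))) ∧
      ∀ v, (L v).2 = (eigenColumns U d' 0)ᴴ * (v.1 * eigenColumns V d 0) := by
  choose L₁ hL₁ hL₁' using fun μ : s => hasFDerivAt_shiftDiff A₀ μ (fun μ => (μ : ℝ))
  choose L₂ hL₂ hL₂' using fun μ : s =>
    (hL₁ μ).schurComplement (π := (eigenColumns V d μ)ᴴ) (G := shiftedPinv V d μ)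
      (ι := eigenColumns V d μ) (contDiff_shiftDiff A₀ μ) (shiftDiff_self A₀ μ)
  have hsub : HasFDerivAt (fun z : Matrix (Fin m) (Fin n) ℂ × (s → ℝ) => z.1 - A₀)
    (ContinuousLinearMap.fst ℝ _ _) (A₀, fun μ => (μ : ℝ)) := hasFDerivAt_fst.sub_const A₀
  obtain ⟨L₃, hL₃, hL₃'⟩ := hsub.schurComplement (π := (eigenColumns U d' 0)ᴴ)
    (G := shiftedPinv V d 0 * A₀ᴴ) (ι := eigenColumns V d 0)
    (contDiff_fst.sub contDiff_const) (sub_self _)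
  refine ⟨_, HasFDerivAt.prodMk (hasFDerivAt_pi.mpr fun μ =>
    (hermitianCoord _).hasFDerivAt.comp _ (hL₂ μ)) hL₃, fun v μ => ?_, fun v => ?_⟩
  · change hermitianCoord _ (L₂ μ v) = _
    rw [hL₂']
    exact congrArg (fun X => hermitianCoord _ ((eigenColumns V d μ)ᴴ * (X * eigenColumns V d μ)))
      (hL₁' μ v)
  · exact hL₃' v

variable {A₀ V d U d' s}

theorem exists_stratumEquation_fderiv_eq (hV : Vᴴ * V = 1) (hU : Uᴴ * U = 1)
    (hH : A₀ᴴ * A₀ = V * diagonal (fun j => ((d j : ℝ) : ℂ)) * Vᴴ)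
    (hs : ∀ μ ∈ s, μ ≠ 0)
    (B : (μ : s) → Matrix {j // d j = (μ : ℝ)} {j // d j = (μ : ℝ)} ℂ) (hB : ∀ μ, (B μ)ᴴ = B μ)
    (C : Matrix {i // d' i = 0} {j // d j = 0} ℂ) :
    ∃ v : Matrix (Fin m) (Fin n) ℂ,
      (∀ μ : s, (eigenColumns V d μ)ᴴ * ((A₀ᴴ * v + vᴴ * A₀) * eigenColumns V d μ) = B μ) ∧
      (eigenColumns U d' 0)ᴴ * (v * eigenColumns V d 0) = C := by
  -- The terms do not interact, since distinct eigenspaces are orthogonal. As `A₀ᴴ * A₀` acts by `μ`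
  -- on its eigencolumns, the factor `(2 μ)⁻¹` makes `A₀ᴴ * v` and its adjoint contribute `B μ / 2`
  -- each.
  let v : Matrix (Fin m) (Fin n) ℂ :=
    ∑ μ : s, (2 * ((μ : ℝ) : ℂ))⁻¹ • (A₀ * eigenColumns V d μ * B μ * (eigenColumns V d μ)ᴴ)
      + eigenColumns U d' 0 * C * (eigenColumns V d 0)ᴴ
  have hv : ∀ μ : s, v * eigenColumns V d μ
      = (2 * ((μ : ℝ) : ℂ))⁻¹ • (A₀ * eigenColumns V d μ * B μ) := by
    intro μ
    have h0 : (eigenColumns V d 0)ᴴ * eigenColumns V d μ = 0 :=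
      eigenColumns_conjTranspose_mul_of_ne hV (hs μ μ.2).symm
    simp only [v, Matrix.add_mul, Matrix.sum_mul, Matrix.mul_assoc, Matrix.smul_mul, h0,
      Matrix.mul_zero, add_zero]
    rw [Finset.sum_eq_single μ]
    · rw [eigenColumns_conjTranspose_mul_self hV, Matrix.mul_one]
    · intro ν _ hν
      rw [eigenColumns_conjTranspose_mul_of_ne hV (fun h => hν (Subtype.ext h))]
      simp
    · simp
  have hv0 : v * eigenColumns V d 0 = eigenColumns U d' 0 * C := by
    simp only [v, Matrix.add_mul, Matrix.sum_mul, Matrix.mul_assoc, Matrix.smul_mul,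
      eigenColumns_conjTranspose_mul_self hV, Matrix.mul_one]
    rw [Finset.sum_eq_zero, zero_add]
    intro ν _
    rw [eigenColumns_conjTranspose_mul_of_ne hV (hs ν ν.2)]
    simp
  refine ⟨v, fun μ => ?_, ?_⟩
  · have h1 : (eigenColumns V d μ)ᴴ * (A₀ᴴ * (v * eigenColumns V d μ)) = (2 : ℂ)⁻¹ • B μ := by
      have h2 : A₀ᴴ * (A₀ * eigenColumns V d μ * B μ)
          = ((μ : ℝ) : ℂ) • (eigenColumns V d μ * B μ) := by
        rw [← Matrix.mul_assoc, ← Matrix.mul_assoc,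
          mul_eigenColumns hV (mul_eq_one_comm.mp hV) hH, Matrix.smul_mul]
      have h3 : ((μ : ℝ) : ℂ) ≠ 0 := by exact_mod_cast hs μ μ.2
      rw [hv, Matrix.mul_smul, h2, Matrix.mul_smul, Matrix.mul_smul, ← Matrix.mul_assoc,
        eigenColumns_conjTranspose_mul_self hV, Matrix.one_mul, smul_smul]
      congr 1
      field_simp
    have h4 : (eigenColumns V d μ)ᴴ * (vᴴ * (A₀ * eigenColumns V d μ)) = (2 : ℂ)⁻¹ • B μ := by
      have h5 := congrArg conjTranspose h1
      have h6 : (B μ)ᴴ = B μ := hB μ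
      simp only [conjTranspose_mul, conjTranspose_conjTranspose, conjTranspose_smul, h6,
        Matrix.mul_assoc] at h5
      rw [h5]
      simp
    rw [Matrix.add_mul, Matrix.mul_add, Matrix.mul_assoc, Matrix.mul_assoc, h1, h4, ← add_smul]
    norm_num
  · rw [hv0, ← Matrix.mul_assoc, eigenColumns_conjTranspose_mul_self hU, Matrix.one_mul]

theorem conjTranspose_eigenColumns_mul_eq_zero (hU : Uᴴ * U = 1)
    (hK : A₀ * A₀ᴴ = U * diagonal (fun j => ((d' j : ℝ) : ℂ)) * Uᴴ) :
    (eigenColumns U d' 0)ᴴ * A₀ = 0 := by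
  rw [← self_mul_conjTranspose_eq_zero, conjTranspose_mul, conjTranspose_conjTranspose,
    Matrix.mul_assoc, ← Matrix.mul_assoc A₀, mul_eigenColumns hU (mul_eq_one_comm.mp hU) hK]
  simp

theorem zeroBlock_pinv_mul (hV : Vᴴ * V = 1)
    (hH : A₀ᴴ * A₀ = V * diagonal (fun j => ((d j : ℝ) : ℂ)) * Vᴴ) :
    shiftedPinv V d 0 * A₀ᴴ * A₀ = 1 - eigenColumns V d 0 * (eigenColumns V d 0)ᴴ := by
  have := shiftedPinv_mul hV (mul_eq_one_comm.mp hV) hH 0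
  rwa [Complex.ofReal_zero, zero_smul, sub_zero, ← Matrix.mul_assoc] at this

/-- `shiftedPinv V d 0 * A₀ᴴ` is the pseudoinverse of `A₀`. The difference `X` of the two sides
kills `A₀` and `j` from the left, hence vanishes, because the range of `A₀` and the columns of `j`
span the whole space. -/
theorem mul_zeroBlock_pinv (hV : Vᴴ * V = 1) (hU : Uᴴ * U = 1)
    (hH : A₀ᴴ * A₀ = V * diagonal (fun j => ((d j : ℝ) : ℂ)) * Vᴴ)
    (hK : A₀ * A₀ᴴ = U * diagonal (fun j => ((d' j : ℝ) : ℂ)) * Uᴴ) :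
    A₀ * (shiftedPinv V d 0 * A₀ᴴ) = 1 - eigenColumns U d' 0 * (eigenColumns U d' 0)ᴴ := by
  set j := eigenColumns U d' 0
  have hjA : jᴴ * A₀ = 0 := conjTranspose_eigenColumns_mul_eq_zero hU hK
  have hAj : A₀ᴴ * j = 0 := by
    have := congrArg conjTranspose hjA
    simpa [conjTranspose_mul] using this
  have hAι : A₀ * eigenColumns V d 0 = 0 := by
    rw [← conjTranspose_mul_self_eq_zero, conjTranspose_mul, Matrix.mul_assoc,
      ← Matrix.mul_assoc A₀ᴴ, mul_eigenColumns hV (mul_eq_one_comm.mp hV) hH]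
    simp
  have hK0 : shiftedPinv U d' 0 * (A₀ * A₀ᴴ) = 1 - j * jᴴ := by
    have := shiftedPinv_mul hU (mul_eq_one_comm.mp hU) hK 0
    rwa [Complex.ofReal_zero, zero_smul, sub_zero] at this
  set X := 1 - j * jᴴ - A₀ * (shiftedPinv V d 0 * A₀ᴴ) with hX
  have hXA : X * A₀ = 0 := by
    rw [hX, Matrix.sub_mul, Matrix.sub_mul, Matrix.one_mul, Matrix.mul_assoc, hjA, Matrix.mul_zero,
      Matrix.mul_assoc, zeroBlock_pinv_mul hV hH, Matrix.mul_sub, ← Matrix.mul_assoc A₀, hAι]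
    simp
  have hXj : X * j = 0 := by
    rw [hX, Matrix.sub_mul, Matrix.sub_mul, Matrix.one_mul, Matrix.mul_assoc,
      eigenColumns_conjTranspose_mul_self hU, Matrix.mul_assoc, Matrix.mul_assoc, hAj]
    simp
  have hXs : Xᴴ = X := by
    simp [hX, conjTranspose_sub, conjTranspose_mul, shiftedPinv_conjTranspose, Matrix.mul_assoc]
  have hX0 : Xᴴ = 0 := by
    have h1 : (X * (A₀ * A₀ᴴ) * shiftedPinv U d' 0)ᴴ = 0 := by
      rw [← Matrix.mul_assoc, hXA]; simp
    have h2 : (X * (j * jᴴ))ᴴ = 0 := by rw [← Matrix.mul_assoc, hXj]; simp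
    rw [conjTranspose_mul, conjTranspose_mul, ← Matrix.mul_assoc, shiftedPinv_conjTranspose,
      conjTranspose_mul A₀, conjTranspose_conjTranspose, hK0, Matrix.sub_mul, Matrix.one_mul,
      sub_eq_zero] at h1
    rw [h1]
    rw [conjTranspose_mul, conjTranspose_mul, conjTranspose_conjTranspose] at h2
    exact h2
  rw [hXs, hX, sub_eq_zero] at hX0
  exact hX0.symm

end StratumEquation

/-! ### The strata are submanifolds. -/

section StrataSubmanifold

open Matrix
open scoped ComplexOrder

theorem image_univ_eq_of_sum_eq {Λ : Type*} [Fintype Λ] {q : Λ → ℝ} {t : Finset ℝ} {b : ℝ → ℕ}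
    (hq : Function.Injective q) (hqt : ∀ μ, q μ ∈ t) (hb : ∀ x ∈ t, 0 < b x)
    (hsum : ∑ μ, b (q μ) = ∑ x ∈ t, b x) : Finset.univ.image q = t := by
  have hsub : Finset.univ.image q ⊆ t := by
    intro x hx
    obtain ⟨μ, -, rfl⟩ := Finset.mem_image.mp hx
    exact hqt μ
  refine hsub.antisymm fun x hx => ?_
  by_contra hxq
  have h1 := Finset.sum_lt_sum_of_subset hsub hx hxq (hb x hx) (fun _ _ _ => Nat.zero_le _)
    (f := b)
  rw [Finset.sum_image hq.injOn, hsum] at h1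
  exact lt_irrefl _ h1

variable {m n : ℕ} {A₀ : Matrix (Fin m) (Fin n) ℂ} {V : Matrix (Fin n) (Fin n) ℂ}
  {d : Fin n → ℝ} {U : Matrix (Fin m) (Fin m) ℂ} {d' : Fin m → ℝ}

/-- The Schur complement lemma for `T = A₀ᴴ * A₀ - μ` and `T + D = Aᴴ * A - x`: multiplicities
cannot grow under small perturbation, and persistence is an equation. -/
theorem eigenMult_le_and_eq_iff (hV : Vᴴ * V = 1)
    (hH : A₀ᴴ * A₀ = V * diagonal (fun j => ((d j : ℝ) : ℂ)) * Vᴴ) {μ x : ℝ}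
    {A : Matrix (Fin m) (Fin n) ℂ}
    (hdet : (1 + shiftedPinv V d μ * shiftDiff A₀ μ A x).det ≠ 0) :
    eigenMult A x ≤ eigenMult A₀ μ ∧ (eigenMult A x = eigenMult A₀ μ ↔
      hermitianCoord _ (schurComplement (eigenColumns V d μ)ᴴ (shiftedPinv V d μ)
        (eigenColumns V d μ) (shiftDiff A₀ μ A x)) = 0) := by
  have hV' := mul_eq_one_comm.mp hV
  have h := rank_add_schurComplement (shiftedPinv_mul hV hV' hH μ)
    (mul_shiftedPinv hV hV' hH μ) (conjTranspose_eigenColumns_mul_shiftedPinv hV μ)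
    (eigenColumns_conjTranspose_mul_self hV μ)
    (conjTranspose_eigenColumns_mul_sub hV hV' hH μ) hdet
  have e : A₀ᴴ * A₀ - (μ : ℂ) • 1 + shiftDiff A₀ μ A x = Aᴴ * A - (x : ℂ) • 1 := by
    rw [shiftDiff]; abel
  rw [e, Fintype.card_fin, ← eigenMult_eq_card hV hH] at h
  rw [hermitianCoord_eq_zero_iff (isHermitian_schurComplement _ (shiftedPinv_conjTranspose μ)
    (shiftDiff_conjTranspose A₀ μ A x) hdet), ← h.2]
  have h2 := rank_sub_add_eigenMult A x
  constructor <;> omega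

theorem rank_le_and_eq_iff (hV : Vᴴ * V = 1) (hU : Uᴴ * U = 1)
    (hH : A₀ᴴ * A₀ = V * diagonal (fun j => ((d j : ℝ) : ℂ)) * Vᴴ)
    (hK : A₀ * A₀ᴴ = U * diagonal (fun j => ((d' j : ℝ) : ℂ)) * Uᴴ)
    {A : Matrix (Fin m) (Fin n) ℂ}
    (hdet : (1 + shiftedPinv V d 0 * A₀ᴴ * (A - A₀)).det ≠ 0) :
    A₀.rank ≤ A.rank ∧ (A.rank = A₀.rank ↔
      schurComplement (eigenColumns U d' 0)ᴴ (shiftedPinv V d 0 * A₀ᴴ)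
        (eigenColumns V d 0) (A - A₀) = 0) := by
  have h := rank_add_schurComplement (zeroBlock_pinv_mul hV hH)
    (mul_zeroBlock_pinv hV hU hH hK)
    (by rw [← Matrix.mul_assoc, conjTranspose_eigenColumns_mul_shiftedPinv hV, Matrix.zero_mul])
    (eigenColumns_conjTranspose_mul_self hV 0)
    (conjTranspose_eigenColumns_mul_eq_zero hU hK) hdet
  rw [add_sub_cancel, Fintype.card_fin, ← eigenMult_eq_card hV hH] at h
  rw [← h.2]
  have h2 := rank_add_eigenMult_zero A₀
  constructor <;> omega

theorem exists_unitary_mul_conjTranspose_self (A : Matrix (Fin m) (Fin n) ℂ) :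
    ∃ U : Matrix (Fin m) (Fin m) ℂ, Uᴴ * U = 1 ∧
      A * Aᴴ = U * diagonal (fun j : Fin m => ((matrixSingularValue Aᴴ j ^ 2 : ℝ) : ℂ)) * Uᴴ := by
  obtain ⟨U, hU, -, hK⟩ := exists_unitary_conjTranspose_mul_self Aᴴ
  rw [conjTranspose_conjTranspose] at hK
  exact ⟨U, hU, hK⟩

theorem eventually_det_ne_zero (G : Matrix (Fin n) (Fin m) ℂ) :
    ∀ᶠ A in 𝓝 A₀, (1 + G * (A - A₀)).det ≠ 0 := by
  have hc : ContDiff ℝ 0 fun A : Matrix (Fin m) (Fin n) ℂ => (1 + G * (A - A₀)).det :=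
    (contDiff_const.add (contDiff_const.matrix_mul (contDiff_id.sub contDiff_const))).matrix_det
  exact hc.continuous.continuousAt.eventually_ne (by simp)

/-- The rank is lower semicontinuous. -/
theorem eventually_rank_le (A₀ : Matrix (Fin m) (Fin n) ℂ) :
    ∀ᶠ A in 𝓝 A₀, A₀.rank ≤ A.rank := by
  obtain ⟨V, hV, -, hH⟩ := exists_unitary_conjTranspose_mul_self A₀
  obtain ⟨U, hU, hK⟩ := exists_unitary_mul_conjTranspose_self A₀
  filter_upwards [eventually_det_ne_zero (A₀ := A₀) (shiftedPinv V _ 0 * A₀ᴴ)] with A hA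
  exact (rank_le_and_eq_iff hV hU hH hK hA).1

/-- For `A` in the stratum, the eigenvalues near those of `A₀` are distinct and as many as allowed,
so they are all the positive ones. Each multiplicity is at most the old one and both sums equal the
common rank, so they agree one by one. Conversely, equal multiplicities already add up to the rank
and leave no room for a further positive eigenvalue. The value of `c` is thus locally automatic and
serves only to fix the dimension. -/
theorem eventually_mem_singularStratum_iff (hV : Vᴴ * V = 1) (hU : Uᴴ * U = 1)
    (hH : A₀ᴴ * A₀ = V * diagonal (fun j => ((d j : ℝ) : ℂ)) * Vᴴ)
    (hK : A₀ * A₀ᴴ = U * diagonal (fun j => ((d' j : ℝ) : ℂ)) * Uᴴ) :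
    ∀ᶠ ε in 𝓝[>] (0 : ℝ), ∀ᶠ A in 𝓝 A₀,
      A ∈ singularStratum m n A₀.rank (posSpectrum A₀).card
          (∑ μ ∈ posSpectrum A₀, eigenMult A₀ μ ^ 2) ↔
        ∃ q : posSpectrum A₀ → ℝ, dist q (fun μ => (μ : ℝ)) < ε ∧
          stratumEquation A₀ V d U d' (posSpectrum A₀) (A, q) = 0 := by
  set s := posSpectrum A₀ with hs
  set p : s → ℝ := fun μ => (μ : ℝ) with hp
  have hdet : ∀ᶠ z : Matrix (Fin m) (Fin n) ℂ × (s → ℝ) in 𝓝 (A₀, p),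
      ∀ μ : s, (1 + shiftedPinv V d μ * shiftDiff A₀ μ z.1 (z.2 μ)).det ≠ 0 := by
    rw [eventually_all]
    intro μ
    have hc : ContDiff ℝ 0 fun z : Matrix (Fin m) (Fin n) ℂ × (s → ℝ) =>
        (1 + shiftedPinv V d μ * shiftDiff A₀ μ z.1 (z.2 μ)).det :=
      (contDiff_const.add (contDiff_const.matrix_mul (contDiff_shiftDiff A₀ μ))).matrix_det
    exact hc.continuous.continuousAt.eventually_ne (by simp [hp, shiftDiff_self])
  obtain ⟨ε₀, hε₀, hdet⟩ := Metric.eventually_nhds_iff.mp hdet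
  filter_upwards [eventually_separated s fun μ => pos_of_mem_posSpectrum, Ioo_mem_nhdsGT hε₀]
    with ε ⟨hε, hpos, hsep⟩ hεε₀
  filter_upwards [eventually_exists_posSpectrum_near A₀ hε hpos, Metric.ball_mem_nhds A₀ hε,
    eventually_det_ne_zero (A₀ := A₀) (shiftedPinv V d 0 * A₀ᴴ)] with A hnear hball hdet₀
  have hrank := (rank_le_and_eq_iff hV hU hH hK hdet₀).2
  have hmult : ∀ q : s → ℝ, dist q p < ε → ∀ μ : s, _ := fun q hq μ =>
    eigenMult_le_and_eq_iff hV hH (hdet (y := (A, q)) (by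
      rw [Prod.dist_eq]
      exact (max_lt hball hq).trans hεε₀.2) μ)
  have hsum₀ : ∑ μ : s, eigenMult A₀ μ = A₀.rank := by
    rw [Finset.sum_coe_sort s (fun μ => eigenMult A₀ μ), hs, sum_eigenMult]
  have hinj : ∀ q : s → ℝ, dist q p < ε → Function.Injective q := by
    intro q hq μ ν hμν
    rw [dist_pi_lt_iff hε] at hq
    exact Subtype.ext (hsep μ μ.2 ν ν.2 (q μ) (hq μ) (by rw [hμν]; exact hq ν))
  constructor
  · rintro ⟨h1, h2, -⟩
    choose! f hf hf' using hnear
    let q : s → ℝ := fun μ => f μ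
    have hq : dist q p < ε := by
      rw [dist_pi_lt_iff hε]
      exact fun μ => hf' μ μ.2
    refine ⟨q, hq, ?_⟩
    have himg : Finset.univ.image q = posSpectrum A := by
      apply Finset.eq_of_subset_of_card_le
      · intro x hx
        obtain ⟨μ, -, rfl⟩ := Finset.mem_image.mp hx
        exact hf μ μ.2
      · rw [h2, Finset.card_image_of_injective _ (hinj q hq)]
        simp
    have hsum : ∑ μ : s, eigenMult A (q μ) = ∑ μ : s, eigenMult A₀ μ := by
      rw [hsum₀, ← h1, ← sum_eigenMult A, ← himg, Finset.sum_image (hinj q hq).injOn]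
    have heq := (Finset.sum_eq_sum_iff_of_le fun μ _ => (hmult q hq μ).1).mp hsum
    refine Prod.ext (funext fun μ => ?_) (hrank.mp h1)
    exact (hmult q hq μ).2.mp (heq μ (Finset.mem_univ _))
  · rintro ⟨q, hq, h0⟩
    have h1 : A.rank = A₀.rank := hrank.mpr (congrArg Prod.snd h0)
    have h2 : ∀ μ, eigenMult A (q μ) = eigenMult A₀ μ := fun μ =>
      (hmult q hq μ).2.mpr (congrFun (congrArg Prod.fst h0) μ)
    have himg : Finset.univ.image q = posSpectrum A := by
      refine image_univ_eq_of_sum_eq (b := eigenMult A) (hinj q hq) (fun μ => ?_)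
        (fun x hx => (mem_posSpectrum_iff.mp hx).2) ?_
      · rw [mem_posSpectrum_iff]
        refine ⟨fun hzero => ?_, ?_⟩
        · have h3 := (dist_pi_lt_iff hε).mp hq μ
          rw [hzero, Real.dist_eq, zero_sub, abs_neg] at h3
          exact absurd (hpos μ μ.2) (not_lt.mpr ((le_abs_self _).trans h3.le))
        · rw [h2]
          exact (mem_posSpectrum_iff.mp μ.2).2
      · rw [sum_eigenMult, h1, ← hsum₀]
        exact Finset.sum_congr rfl fun μ _ => h2 μ
    refine ⟨h1, ?_, ?_⟩
    · rw [← himg, Finset.card_image_of_injective _ (hinj q hq)]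
      simp
    · rw [← himg, Finset.sum_image (hinj q hq).injOn,
        ← Finset.sum_coe_sort s (fun μ => eigenMult A₀ μ ^ 2)]
      exact Finset.sum_congr rfl fun μ _ => by rw [h2]

/-- The count in `he`: `2 m n` coordinates of `A` and one parameter per eigenvalue, against the
numbers of real equations. -/
theorem hasSliceChartAt_singularStratum (A₀ : Matrix (Fin m) (Fin n) ℂ) {e : ℕ}
    (he : e + (∑ μ ∈ posSpectrum A₀, eigenMult A₀ μ ^ 2 + 2 * ((m - A₀.rank) * (n - A₀.rank)))
      = 2 * (m * n) + (posSpectrum A₀).card) :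
    HasSliceChartAt e (singularStratum m n A₀.rank (posSpectrum A₀).card
      (∑ μ ∈ posSpectrum A₀, eigenMult A₀ μ ^ 2)) A₀ := by
  obtain ⟨V, hV, -, hH⟩ := exists_unitary_conjTranspose_mul_self A₀
  obtain ⟨U, hU, hK⟩ := exists_unitary_mul_conjTranspose_self A₀
  set d : Fin n → ℝ := fun j => matrixSingularValue A₀ j ^ 2 with hd
  set d' : Fin m → ℝ := fun j => matrixSingularValue A₀ᴴ j ^ 2 with hd'
  obtain ⟨L, hL, hL₁, hL₂⟩ := hasFDerivAt_stratumEquation A₀ V d U d' (posSpectrum A₀)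
  have hs : ∀ μ ∈ posSpectrum A₀, μ ≠ 0 := fun μ hμ => (mem_posSpectrum_iff.mp hμ).1
  refine hasSliceChartAt_of_parametric_submersion
    (contDiff_stratumEquation A₀ V d U d' (posSpectrum A₀)).contDiffAt hL
    (stratumEquation_self A₀ V d U d' (posSpectrum A₀)) ?_ ?_
    (eventually_mem_singularStratum_iff hV hU hH hK) ?_
  · rintro ⟨b, C⟩
    choose B hB hBb using fun μ => exists_hermitianCoord_eq (b μ)
    obtain ⟨v, hv₁, hv₂⟩ := exists_stratumEquation_fderiv_eq hV hU hH hs B hB C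
    refine ⟨(v, 0), Prod.ext (funext fun μ => ?_) ?_⟩
    · refine (hL₁ (v, 0) μ).trans ?_
      simp only [Pi.zero_apply, Complex.ofReal_zero, zero_smul, sub_zero]
      rw [hv₁, hBb]
    · exact (hL₂ (v, 0)).trans hv₂
  -- Varying the parameter alone changes the block of `μ` by `-(w μ) • 1`, and the block is not
  -- empty.
  · intro w hw
    funext μ
    have h1 := (hL₁ (0, w) μ).symm.trans (congrFun (congrArg Prod.fst hw) μ)
    have h2 : (eigenColumns V d μ)ᴴ * ((A₀ᴴ * (0 : Matrix (Fin m) (Fin n) ℂ)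
        + (0 : Matrix (Fin m) (Fin n) ℂ)ᴴ * A₀
        - ((w μ : ℝ) : ℂ) • (1 : Matrix (Fin n) (Fin n) ℂ)) * eigenColumns V d μ)
        = (-(w μ : ℝ) : ℂ) • 1 := by
      rw [Matrix.mul_zero, conjTranspose_zero, Matrix.zero_mul, add_zero, zero_sub, Matrix.neg_mul,
        Matrix.mul_neg, Matrix.smul_mul, Matrix.one_mul, Matrix.mul_smul,
        eigenColumns_conjTranspose_mul_self hV, neg_smul]
    rw [h2] at h1
    replace h1 := (hermitianCoord_eq_zero_iff (by simp [conjTranspose_smul])).mp h1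
    obtain ⟨j, hj⟩ := eigenMult_pos_iff.mp (mem_posSpectrum_iff.mp μ.2).2
    have h3 := congrFun (congrFun h1 ⟨j, hj⟩) ⟨j, hj⟩
    simpa using h3
  · have hcard : ∀ μ : ℝ, Fintype.card {j : Fin n // d j = μ} = eigenMult A₀ μ := fun μ => rfl
    have hcard' : Fintype.card {i : Fin m // d' i = 0} = eigenMult A₀ᴴ 0 := rfl
    have h1 := rank_add_eigenMult_zero A₀
    have h2 := rank_add_eigenMult_zero A₀ᴴ
    rw [rank_conjTranspose] at h2
    rw [Module.finrank_prod, Module.finrank_pi_fintype, finrank_real_matrix, finrank_real_matrix,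
      Module.finrank_fintype_fun_eq_card, hcard, hcard']
    simp only [Module.finrank_fin_fun, hcard, Fintype.card_fin, Fintype.card_coe]
    rw [Finset.sum_coe_sort (posSpectrum A₀) (fun μ => eigenMult A₀ μ ^ 2), ← he]
    have h3 : m - A₀.rank = eigenMult A₀ᴴ 0 := by omega
    have h4 : n - A₀.rank = eigenMult A₀ 0 := by omega
    rw [h3, h4]

/-- Each singular stratum is a submanifold. -/
theorem isSmoothSubmanifold_singularStratum {ρ r c e : ℕ}
    (he : e + (c + 2 * ((m - ρ) * (n - ρ))) = 2 * (m * n) + r) :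
    IsSmoothSubmanifold e (singularStratum m n ρ r c) := by
  rintro A₀ ⟨rfl, rfl, rfl⟩
  exact hasSliceChartAt_singularStratum A₀ he

end StrataSubmanifold

/-! ### Repeated singular values: the generic stratum, its density, and the dimensions of the
others. -/

section RepeatedSingularValues

open Matrix
open scoped ComplexOrder

variable {m n : ℕ}

theorem matrixSingularValue_pos_iff (A : Matrix (Fin m) (Fin n) ℂ) (i : ℕ) :
    0 < matrixSingularValue A i ↔ i < A.rank := by
  rw [matrixSingularValue, LinearMap.singularValues_pos_iff_lt_finrank_range,
    Matrix.rank_eq_finrank_range_toLin A (EuclideanSpace.basisFun (Fin m) ℂ).toBasis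
      (EuclideanSpace.basisFun (Fin n) ℂ).toBasis, Matrix.toEuclideanLin_eq_toLin_orthonormal]

theorem matrixSingularValue_nonneg (A : Matrix (Fin m) (Fin n) ℂ) (i : ℕ) :
    0 ≤ matrixSingularValue A i :=
  LinearMap.singularValues_nonneg _ i

theorem matrixSingularValue_eq_zero_iff (A : Matrix (Fin m) (Fin n) ℂ) (i : ℕ) :
    matrixSingularValue A i = 0 ↔ A.rank ≤ i := by
  rw [← not_lt, ← matrixSingularValue_pos_iff, not_lt]
  exact ⟨fun h => h.le, fun h => le_antisymm h (matrixSingularValue_nonneg A i)⟩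

theorem posSpectrum_eq_image (A : Matrix (Fin m) (Fin n) ℂ) :
    posSpectrum A = (Finset.range A.rank).image fun i => matrixSingularValue A i ^ 2 := by
  ext μ
  simp only [posSpectrum, Finset.mem_erase, Finset.mem_image, Finset.mem_univ, true_and,
    Finset.mem_range]
  constructor
  · rintro ⟨h0, j, rfl⟩
    refine ⟨j, ?_, rfl⟩
    rw [← matrixSingularValue_pos_iff]
    exact lt_of_le_of_ne (matrixSingularValue_nonneg A j) fun h => h0 (by rw [← h]; simp)
  · rintro ⟨i, hi, rfl⟩
    have hin : i < n := hi.trans_le (by simpa using A.rank_le_width)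
    have := (matrixSingularValue_pos_iff A i).mpr hi
    exact ⟨by positivity, ⟨i, hin⟩, rfl⟩

theorem rank_le_min (A : Matrix (Fin m) (Fin n) ℂ) : A.rank ≤ min m n :=
  le_min A.rank_le_height A.rank_le_width

/-- A coincidence occurs either among the positive singular values or as two zeros among the first
`min m n`; the right side negates the absence of both. -/
theorem mem_repeatedSingularValueSet_iff (A : Matrix (Fin m) (Fin n) ℂ) :
    A ∈ repeatedSingularValueSet m n ↔
      ¬((posSpectrum A).card = A.rank ∧ min m n ≤ A.rank + 1) := by
  have hcard : (posSpectrum A).card = A.rank ↔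
      Set.InjOn (fun i => matrixSingularValue A i ^ 2) (Finset.range A.rank : Set ℕ) := by
    rw [← Finset.card_image_iff, ← posSpectrum_eq_image, Finset.card_range]
  have hp := rank_le_min A
  rw [hcard, ← not_iff_not, not_not]
  constructor
  · intro h
    have hne : ∀ i j, i < j → j < min m n → matrixSingularValue A i ≠ matrixSingularValue A j :=
      fun i j hij hj he => h ⟨i, j, hij, hj, he⟩
    constructor
    · intro i hi j hj hij
      simp only [Finset.coe_range, Set.mem_Iio] at hi hj
      have he := (pow_left_inj₀ (matrixSingularValue_nonneg A i) (matrixSingularValue_nonneg A j)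
        two_ne_zero).mp hij
      rcases lt_trichotomy i j with h1 | h1 | h1
      · exact absurd he (hne i j h1 (by omega))
      · exact h1
      · exact absurd he.symm (hne j i h1 (by omega))
    · by_contra hlt
      apply hne A.rank (A.rank + 1) (by omega) (by omega)
      rw [(matrixSingularValue_eq_zero_iff A _).mpr le_rfl,
        (matrixSingularValue_eq_zero_iff A _).mpr (by omega)]
  · rintro ⟨hinj, hle⟩ ⟨i, j, hij, hj, he⟩
    by_cases hjr : j < A.rank
    · have := hinj (x₁ := i) (x₂ := j) (by simp; omega) (by simpa using hjr) (by simp only [he])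
      omega
    · have h0 := (matrixSingularValue_eq_zero_iff A j).mpr (by omega)
      have := (matrixSingularValue_eq_zero_iff A i).mp (he.trans h0)
      omega

/-- The rectangular matrix with the entries of `τ` on its main diagonal. -/
def rectDiagonal (m n : ℕ) (τ : ℕ → ℝ) : Matrix (Fin m) (Fin n) ℂ :=
  Matrix.of fun i j => if i.val = j.val then ((τ j : ℝ) : ℂ) else 0

theorem mul_rectDiagonal_apply (U : Matrix (Fin m) (Fin m) ℂ) (τ : ℕ → ℝ) (i : Fin m)
    (j : Fin n) :
    (U * rectDiagonal m n τ) i j = if h : j.val < m then U i ⟨j, h⟩ * ((τ j : ℝ) : ℂ) else 0 := by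
  rw [Matrix.mul_apply]
  split_ifs with h
  · rw [Finset.sum_eq_single ⟨j, h⟩]
    · simp [rectDiagonal]
    · intro k _ hk
      have : k.val ≠ j.val := fun e => hk (Fin.ext e)
      simp [rectDiagonal, this]
    · simp
  · refine Finset.sum_eq_zero fun k _ => ?_
    have : k.val ≠ j.val := fun e => h (e ▸ k.2)
    simp [rectDiagonal, this]

theorem rectDiagonal_conjTranspose_mul_self (τ : ℕ → ℝ) :
    (rectDiagonal m n τ)ᴴ * rectDiagonal m n τ
      = diagonal fun j : Fin n => (((if j.val < m then τ j ^ 2 else 0 : ℝ)) : ℂ) := by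
  ext i j
  rw [Matrix.mul_apply, Matrix.diagonal_apply]
  by_cases hi : i.val < m
  · rw [Finset.sum_eq_single ⟨i, hi⟩]
    · by_cases hij : i = j
      · subst hij; simp [rectDiagonal, hi, sq]
      · have : i.val ≠ j.val := fun e => hij (Fin.ext e)
        simp [rectDiagonal, this, hij]
    · intro k _ hk
      have : k.val ≠ i.val := fun e => hk (Fin.ext e)
      simp [rectDiagonal, this]
    · simp
  · rw [Finset.sum_eq_zero]
    · simp [hi]
    · intro k _
      have : k.val ≠ i.val := fun e => hi (e ▸ k.2)
      simp [rectDiagonal, this]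

/-- The singular value decomposition. -/
theorem exists_singular_value_decomposition (A : Matrix (Fin m) (Fin n) ℂ) :
    ∃ (U : Matrix (Fin m) (Fin m) ℂ) (V : Matrix (Fin n) (Fin n) ℂ), Uᴴ * U = 1 ∧ Vᴴ * V = 1 ∧
      A = U * rectDiagonal m n (matrixSingularValue A) * Vᴴ := by
  obtain ⟨V, hV, hV', hH⟩ := exists_unitary_conjTranspose_mul_self A
  set W := A * V with hWdef
  have hW : Wᴴ * W = diagonal (fun j : Fin n => ((matrixSingularValue A j ^ 2 : ℝ) : ℂ)) := by
    rw [hWdef, conjTranspose_mul, Matrix.mul_assoc, ← Matrix.mul_assoc Aᴴ, hH, Matrix.mul_assoc,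
      Matrix.mul_assoc, hV, Matrix.mul_one, ← Matrix.mul_assoc, hV, Matrix.one_mul]
  have hWij : ∀ i j : Fin n, ∑ k, star (W k i) * W k j
      = if i = j then ((matrixSingularValue A j ^ 2 : ℝ) : ℂ) else 0 := by
    intro i j
    have := congrFun (congrFun hW i) j
    rw [Matrix.mul_apply, Matrix.diagonal_apply] at this
    rw [show (∑ k, star (W k i) * W k j) = ∑ k, Wᴴ i k * W k j from rfl, this]
    split_ifs with h
    · rw [h]
    · rfl
  -- The left singular vectors: columns of `A * V` divided by their lengths. Only those with index
  -- below the rank are used; they are extended to an orthonormal basis.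
  let u : Fin m → EuclideanSpace ℂ (Fin m) := fun i =>
    if h : i.val < n then
      WithLp.toLp 2 fun k => (((matrixSingularValue A i)⁻¹ : ℝ) : ℂ) * W k ⟨i, h⟩
    else 0
  let s : Set (Fin m) := {i | i.val < A.rank}
  have hrn : A.rank ≤ n := A.rank_le_width
  have hrm : A.rank ≤ m := A.rank_le_height
  have hu : Orthonormal ℂ (s.domRestrict u) := by
    rw [orthonormal_iff_ite]
    rintro ⟨i, hi⟩ ⟨j, hj⟩
    have hi' : i.val < A.rank := hi
    have hj' : j.val < A.rank := hj
    have hin : i.val < n := by omega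
    have hjn : j.val < n := by omega
    have h1 : inner ℂ (u i) (u j) = (((matrixSingularValue A i)⁻¹ : ℝ) : ℂ)
        * (((matrixSingularValue A j)⁻¹ : ℝ) : ℂ) * ∑ k, star (W k ⟨i, hin⟩) * W k ⟨j, hjn⟩ := by
      simp only [u, hin, hjn, dif_pos, PiLp.inner_apply, Finset.mul_sum]
      refine Finset.sum_congr rfl fun k _ => ?_
      simp only [RCLike.inner_apply, map_mul, Complex.conj_ofReal]
      simp only [starRingEnd_apply]
      ring
    change inner ℂ (u i) (u j) = _
    rw [h1, hWij]
    have hj0 := ((matrixSingularValue_pos_iff A j).mpr hj').ne'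
    by_cases hij : i = j
    · subst hij
      simp only [if_true, ← Complex.ofReal_mul]
      rw [← Complex.ofReal_one]
      congr 1
      field_simp
    · have h2 : (⟨i, hin⟩ : Fin n) ≠ ⟨j, hjn⟩ := fun e => hij (Fin.ext (by simpa using e))
      simp [h2, hij]
  obtain ⟨b, hb⟩ := hu.exists_orthonormalBasis_extension_of_card_eq (by simp)
  let U : Matrix (Fin m) (Fin m) ℂ := Matrix.of fun i j => b j i
  have hU : Uᴴ * U = 1 := by
    ext i j
    have := orthonormal_iff_ite.mp b.orthonormal i j
    rw [Matrix.one_apply, ← this]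
    simp [U, Matrix.mul_apply, PiLp.inner_apply, mul_comm]
  refine ⟨U, V, hU, hV, ?_⟩
  have key : W = U * rectDiagonal m n (matrixSingularValue A) := by
    ext i j
    rw [mul_rectDiagonal_apply]
    by_cases hj : j.val < A.rank
    · have hjm : j.val < m := by omega
      have h1 : b ⟨j, hjm⟩ = u ⟨j, hjm⟩ := hb ⟨j, hjm⟩ hj
      have h2 : U i ⟨j, hjm⟩ = (((matrixSingularValue A j)⁻¹ : ℝ) : ℂ) * W i j := by
        change b ⟨j, hjm⟩ i = _
        rw [h1]
        simp [u]
      have h3 : ((matrixSingularValue A j : ℝ) : ℂ) ≠ 0 := by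
        exact_mod_cast ((matrixSingularValue_pos_iff A j).mpr hj).ne'
      rw [dif_pos hjm, h2]
      push_cast
      field_simp
    · have h0 : matrixSingularValue A j = 0 :=
        (matrixSingularValue_eq_zero_iff A j).mpr (by omega)
      have h1 : (fun k => W k j) = 0 := by
        rw [← dotProduct_star_self_eq_zero, dotProduct_comm]
        have := hWij j j
        rw [if_pos rfl, h0] at this
        simpa [dotProduct, mul_comm] using this
      have h2 : W i j = 0 := congrFun h1 i
      simp [h2, h0]
  rw [← key, hWdef, Matrix.mul_assoc, hV', Matrix.mul_one]

/-- The set of matrices of full rank with exactly one repeated singular value. -/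
theorem singularStratum_eq_inter (hm : 2 ≤ m) (hn : 2 ≤ n) :
    singularStratum m n (min m n) (min m n - 1) (min m n + 2) =
      repeatedSingularValueSet m n ∩
        {A | min m n ≤ A.rank ∧ min m n - 1 ≤ (posSpectrum A).card} := by
  have hp : 2 ≤ min m n := le_min hm hn
  ext A
  rw [Set.mem_inter_iff, mem_repeatedSingularValueSet_iff]
  constructor
  · rintro ⟨h1, h2, -⟩
    refine ⟨fun h => ?_, ?_, ?_⟩ <;> omega
  · rintro ⟨h1, h2, h3⟩
    have h4 := rank_le_min A
    have h5 := card_posSpectrum_le_rank A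
    have hr : A.rank = min m n := le_antisymm h4 h2
    have hc : (posSpectrum A).card = min m n - 1 := by
      have : ¬(posSpectrum A).card = A.rank := fun h => h1 ⟨h, by omega⟩
      omega
    refine ⟨hr, hc, ?_⟩
    have hk : ∀ μ ∈ posSpectrum A, 1 ≤ eigenMult A μ := fun μ hμ => (mem_posSpectrum_iff.mp hμ).2
    have hsum : ∑ μ ∈ posSpectrum A, (eigenMult A μ - 1) = 1 := by
      have h6 : ∑ μ ∈ posSpectrum A, (eigenMult A μ - 1) + (posSpectrum A).card
          = ∑ μ ∈ posSpectrum A, eigenMult A μ := by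
        rw [Finset.card_eq_sum_ones, ← Finset.sum_add_distrib]
        exact Finset.sum_congr rfl fun μ hμ => Nat.sub_add_cancel (hk μ hμ)
      rw [sum_eigenMult] at h6
      omega
    -- The multiplicities exceed `1` by a total of `1`, so each is `1` or `2`, where the square is
    -- affine.
    have hsq : ∀ μ ∈ posSpectrum A, eigenMult A μ ^ 2 = 3 * (eigenMult A μ - 1) + 1 := by
      intro μ hμ
      have h7 : eigenMult A μ - 1 ≤ 1 := by
        exact (Finset.single_le_sum (f := fun μ => eigenMult A μ - 1)
          (fun _ _ => Nat.zero_le _) hμ).trans hsum.le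
      have h8 := hk μ hμ
      have h9 : eigenMult A μ = 1 ∨ eigenMult A μ = 2 := by omega
      rcases h9 with h | h <;> simp [h]
    rw [Finset.sum_congr rfl hsq, Finset.sum_add_distrib, ← Finset.mul_sum, hsum,
      ← Finset.card_eq_sum_ones, hc]
    omega

theorem isOpen_rank_card_ge (a b : ℕ) :
    IsOpen {A : Matrix (Fin m) (Fin n) ℂ | a ≤ A.rank ∧ b ≤ (posSpectrum A).card} := by
  rw [isOpen_iff_mem_nhds]
  rintro A₀ ⟨h1, h2⟩
  filter_upwards [eventually_rank_le A₀, eventually_card_posSpectrum_le A₀] with A h3 h4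
  exact ⟨h1.trans h3, h2.trans h4⟩

theorem mul_rectDiagonal_mem_singularStratum (hm : 2 ≤ m) (hn : 2 ≤ n)
    {U : Matrix (Fin m) (Fin m) ℂ} {V : Matrix (Fin n) (Fin n) ℂ}
    (hU : Uᴴ * U = 1) (hV : Vᴴ * V = 1) {τ : ℕ → ℝ} (hτ : ∀ i < min m n, 0 < τ i) {a b : ℕ}
    (hab : a < b) (hb : b < min m n) (hτab : τ a = τ b)
    (hinj : Set.InjOn τ ((Finset.range (min m n)).erase b)) :
    U * rectDiagonal m n τ * Vᴴ
      ∈ singularStratum m n (min m n) (min m n - 1) (min m n + 2) := by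
  set A := U * rectDiagonal m n τ * Vᴴ with hA
  set p := min m n with hp
  let d : Fin n → ℝ := fun j => if j.val < m then τ j ^ 2 else 0
  have hH : Aᴴ * A = V * diagonal (fun j => ((d j : ℝ) : ℂ)) * Vᴴ := by
    have : Aᴴ * A = V * ((rectDiagonal m n τ)ᴴ * ((Uᴴ * U) * rectDiagonal m n τ)) * Vᴴ := by
      rw [hA]
      simp only [conjTranspose_mul, conjTranspose_conjTranspose, Matrix.mul_assoc]
    rw [this, hU, Matrix.one_mul, rectDiagonal_conjTranspose_mul_self]
  have hmult := eigenMult_eq_card hV hH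
  have hrank : A.rank = p := by
    refine le_antisymm (rank_le_min A) ?_
    have h1 := rank_add_eigenMult_zero A
    rw [hmult] at h1
    have h2 := Fintype.card_subtype_compl fun j => d j = 0
    have h3 := Fintype.card_subtype_le fun j => d j = 0
    have h4 : p ≤ Fintype.card {j // ¬d j = 0} := by
      have h5 : ∀ i : Fin p, i.val < m ∧ i.val < n := fun i => lt_min_iff.mp (hp ▸ i.2)
      let g : Fin p → {j // ¬d j = 0} := fun i => ⟨⟨i, (h5 i).2⟩, by
        have := hτ i i.2
        simp only [d, (h5 i).1, if_true]
        positivity⟩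
      have hg : Function.Injective g := by
        intro i j hij
        have := congrArg (fun x => x.1.val) hij
        exact Fin.ext this
      simpa using Fintype.card_le_of_injective g hg
    rw [Fintype.card_fin] at h2 h3
    omega
  have hspec : posSpectrum A = ((Finset.range p).erase b).image fun i => τ i ^ 2 := by
    ext μ
    rw [mem_posSpectrum_iff, hmult, Fintype.card_pos_iff, nonempty_subtype]
    simp only [Finset.mem_image, Finset.mem_erase, Finset.mem_range]
    constructor
    · rintro ⟨h0, j, hj⟩
      by_cases hjm : j.val < m
      · have hjd : τ j ^ 2 = μ := by simpa [d, hjm] using hj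
        by_cases hjb : j.val = b
        · exact ⟨a, ⟨hab.ne, hab.trans hb⟩, by rw [hτab, ← hjb, hjd]⟩
        · exact ⟨j, ⟨hjb, lt_min hjm j.2⟩, hjd⟩
      · simp only [d, hjm, if_false] at hj
        exact absurd hj.symm h0
    · rintro ⟨i, ⟨-, hi⟩, rfl⟩
      have := hτ i hi
      have hi' := lt_min_iff.mp hi
      exact ⟨by positivity, ⟨i, hi'.2⟩, by simp [d, hi'.1]⟩
  have hcard : (posSpectrum A).card = p - 1 := by
    rw [hspec, Finset.card_image_of_injOn, Finset.card_erase_of_mem (Finset.mem_range.mpr hb),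
      Finset.card_range]
    intro i hi j hj hij
    have hi' := hτ i (by simpa using (Finset.mem_erase.mp hi).2)
    have hj' := hτ j (by simpa using (Finset.mem_erase.mp hj).2)
    exact hinj hi hj ((pow_left_inj₀ hi'.le hj'.le two_ne_zero).mp hij)
  rw [singularStratum_eq_inter hm hn]
  refine ⟨?_, hrank.ge, hcard.ge⟩
  rw [mem_repeatedSingularValueSet_iff]
  omega

theorem repeatedSingularValueSet_subset_closure (hm : 2 ≤ m) (hn : 2 ≤ n) :
    repeatedSingularValueSet m n ⊆
      closure (singularStratum m n (min m n) (min m n - 1) (min m n + 2)) := by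
  rintro A ⟨a, b, hab, hb, hσ⟩
  obtain ⟨U, V, hU, hV, hA⟩ := exists_singular_value_decomposition A
  set p := min m n with hp
  -- Adding `t * (p - i)` to the nonincreasing singular values makes them positive and strictly
  -- decreasing. The index `b` receives the weight of `a`, so the coincidence of `a` and `b`
  -- survives.
  let w : ℕ → ℝ := fun i => if i = b then (p : ℝ) - a else (p : ℝ) - i
  let τ : ℝ → ℕ → ℝ := fun t i => matrixSingularValue A i + t * w i
  let f : ℝ → Matrix (Fin m) (Fin n) ℂ := fun t => U * rectDiagonal m n (τ t) * Vᴴ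
  have hf0 : f 0 = A := by
    have : τ 0 = matrixSingularValue A := by funext i; simp [τ]
    simp only [f, this]
    exact hA.symm
  have hD : ContDiff ℝ 0 fun t => rectDiagonal m n (τ t) := by
    rw [contDiff_matrix]
    intro i j
    by_cases hij : i.val = j.val
    · simp only [rectDiagonal, Matrix.of_apply, hij, if_true, τ]
      exact Complex.ofRealCLM.contDiff.comp
        (contDiff_const.add (contDiff_id.mul contDiff_const))
    · simp only [rectDiagonal, Matrix.of_apply, hij, if_false]
      exact contDiff_const
  have hf : Continuous f := ((contDiff_const.matrix_mul hD).matrix_mul contDiff_const).continuous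
  have htend : Tendsto f (𝓝[>] 0) (𝓝 A) := by
    rw [← hf0]
    exact hf.continuousAt.tendsto.mono_left nhdsWithin_le_nhds
  refine mem_closure_of_tendsto htend ?_
  filter_upwards [eventually_mem_nhdsWithin] with t ht
  have ht' : 0 < t := ht
  refine mul_rectDiagonal_mem_singularStratum hm hn hU hV (fun i hi => ?_) hab hb ?_ ?_
  · have h1 : 0 < w i := by
      have hi' : (i : ℝ) < p := by exact_mod_cast hi
      have ha' : (a : ℝ) < p := by exact_mod_cast hab.trans hb
      simp only [w]
      split_ifs <;> linarith
    have h2 := matrixSingularValue_nonneg A i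
    have h3 := mul_pos ht' h1
    simp only [τ]
    linarith
  · simp [τ, w, hab.ne, hσ]
  · have hanti : ∀ i j, i ≠ b → j ≠ b → i < j → τ t j < τ t i := by
      intro i j hi hj hij
      have h1 : matrixSingularValue A j ≤ matrixSingularValue A i :=
        LinearMap.singularValues_antitone _ hij.le
      have h2 : (i : ℝ) < j := by exact_mod_cast hij
      simp only [τ, w, hi, hj, if_false]
      have : t * ((p : ℝ) - j) < t * ((p : ℝ) - i) := mul_lt_mul_of_pos_left (by linarith) ht'
      linarith
    intro i hi j hj hij
    have hi' := (Finset.mem_erase.mp hi).1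
    have hj' := (Finset.mem_erase.mp hj).1
    rcases lt_trichotomy i j with h | h | h
    · exact absurd hij (hanti i j hi' hj' h).ne'
    · exact h
    · exact absurd hij (hanti j i hj' hi' h).ne

/-- The strata of repeated singular values other than the generic one have smaller dimension. -/
theorem exists_isSmoothSubmanifold_singularStratum (hm : 2 ≤ m) (hn : 2 ≤ n) {ρ r c : ℕ}
    (h1 : ¬(r = ρ ∧ min m n ≤ ρ + 1)) (h2 : ¬(ρ = min m n ∧ r = min m n - 1)) :
    ∃ e, e < 2 * (m * n) - 3 ∧ IsSmoothSubmanifold e (singularStratum m n ρ r c) := by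
  have hmn : 4 ≤ m * n := Nat.mul_le_mul hm hn
  rcases (singularStratum m n ρ r c).eq_empty_or_nonempty with h | ⟨A, hA1, hA2, hA3⟩
  · exact ⟨0, by omega, by rw [h]; exact fun x hx => hx.elim⟩
  have hρ := rank_le_min A
  have hr := card_posSpectrum_le_rank A
  have hsum := sum_eigenMult A
  -- Used to see that the codimension is at most `2 m n`, so that `e` exists as a natural number.
  have hc : c ≤ ρ ^ 2 := by
    rw [← hA3, ← hA1, ← hsum]
    exact Finset.sum_sq_le_sq_sum_of_nonneg (fun _ _ => Nat.zero_le _)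
  -- The sum over the spectrum of `(k - 1) (k - 2) ≥ 0`. It gives `c - r ≥ 3 (ρ - r)`.
  have hc' : 3 * ρ ≤ c + 2 * r := by
    rw [← hA3, ← hA1, ← hsum, ← hA2, Finset.card_eq_sum_ones, Finset.mul_sum, Finset.mul_sum,
      ← Finset.sum_add_distrib]
    refine Finset.sum_le_sum fun μ hμ => ?_
    have := (mem_posSpectrum_iff.mp hμ).2
    obtain h | h : eigenMult A μ = 1 ∨ 2 ≤ eigenMult A μ := by omega
    · simp [h]
    · nlinarith
  rw [hA1] at hρ hr
  rw [hA2] at hr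
  obtain ⟨x, hx⟩ : ∃ x, m = ρ + x := Nat.exists_eq_add_of_le (hρ.trans (min_le_left _ _))
  obtain ⟨y, hy⟩ : ∃ y, n = ρ + y := Nat.exists_eq_add_of_le (hρ.trans (min_le_right _ _))
  have hxy : (m - ρ) * (n - ρ) = x * y := by rw [hx, hy]; simp
  have hle : c + 2 * (x * y) ≤ 2 * (m * n) + r := by rw [hx, hy]; nlinarith
  obtain ⟨e, he⟩ := Nat.exists_eq_add_of_le' hle
  refine ⟨e, ?_, isSmoothSubmanifold_singularStratum (e := e) (by rw [hxy]; exact he.symm)⟩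
  -- If `ρ ≤ p - 2`, the rank term is at least `8`. If `ρ = p - 1`, then `r < ρ`, giving at least `3
  -- + 2`. If `ρ = p`, then `r ≤ p - 2`, giving at least `6`.
  have hbig : r + 4 ≤ c + 2 * (x * y) := by
    rcases Nat.lt_or_ge ρ (min m n - 1) with h | h
    · have hx2 : 2 ≤ x := by have := min_le_left m n; omega
      have hy2 : 2 ≤ y := by have := min_le_right m n; omega
      have := Nat.mul_le_mul hx2 hy2
      omega
    · rcases Nat.eq_or_lt_of_le hρ with h3 | h3
      · omega
      · have hx1 : 1 ≤ x := by have := min_le_left m n; omega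
        have hy1 : 1 ≤ y := by have := min_le_right m n; omega
        have := Nat.mul_le_mul hx1 hy1
        omega
  omega

end RepeatedSingularValues

/-! ### Assembly of the stratification. -/

theorem mainTheorem3 (m n : ℕ) (hm : 2 ≤ m) (hn : 2 ≤ n) :
    HasRealCodimension (repeatedSingularValueSet m n) 3 := by
  have hp : 2 ≤ min m n := le_min hm hn
  have hmn : 4 ≤ m * n := Nat.mul_le_mul hm hn
  refine ⟨⟨0, ?_⟩, 2 * (m * n) - 3,
    singularStratum m n (min m n) (min m n - 1) (min m n + 2), ?_, ?_,
    ⟨_, isOpen_rank_card_ge _ _, singularStratum_eq_inter hm hn⟩,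
    repeatedSingularValueSet_subset_closure hm hn, ?_⟩
  · rw [mem_repeatedSingularValueSet_iff, Matrix.rank_zero]
    omega
  · rw [finrank_real_matrix, Fintype.card_fin, Fintype.card_fin]
    omega
  · apply isSmoothSubmanifold_singularStratum
    have : (m - min m n) * (n - min m n) = 0 := by
      rcases min_choice m n with h | h <;> simp [h]
    omega
  · let P : ℕ → ℕ → Prop := fun ρ r =>
      ¬(r = ρ ∧ min m n ≤ ρ + 1) ∧ ¬(ρ = min m n ∧ r = min m n - 1)
    let I := {t : Fin (min m n + 1) × Fin (min m n + 1) × Fin (min m n ^ 2 + 1) //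
      P t.1.val t.2.1.val}
    -- The triples `(ρ, r, c)` in `I` cover the singular part since `c ≤ ρ ^ 2 ≤ p ^ 2`. Excluding
    -- the generic pair `(ρ, r)` needs no mention of `c`, which that pair determines.
    have : Fintype I := Fintype.ofFinite I
    choose e he using fun t : I =>
      exists_isSmoothSubmanifold_singularStratum hm hn (c := t.1.2.2.val) t.2.1 t.2.2
    let g := (Fintype.equivFin I).symm
    refine ⟨Fintype.card I, fun i => singularStratum m n (g i).1.1 (g i).1.2.1 (g i).1.2.2,
      fun i => e (g i), ?_, fun i => he (g i)⟩
    ext A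
    rw [singularStratum_eq_inter hm hn, Set.sdiff_self_inter, Set.mem_sdiff, Set.mem_iUnion,
      mem_repeatedSingularValueSet_iff]
    have hr := rank_le_min A
    have hc := card_posSpectrum_le_rank A
    constructor
    · rintro ⟨h1, h2⟩
      have h3 : ∑ μ ∈ posSpectrum A, eigenMult A μ ^ 2 ≤ min m n ^ 2 := by
        refine (Finset.sum_sq_le_sq_sum_of_nonneg fun _ _ => Nat.zero_le _).trans ?_
        rw [sum_eigenMult]
        exact Nat.pow_le_pow_left hr 2
      let t : I := ⟨(⟨A.rank, by omega⟩, ⟨(posSpectrum A).card, by omega⟩,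
        ⟨∑ μ ∈ posSpectrum A, eigenMult A μ ^ 2, by omega⟩), h1, fun h => h2 ⟨h.1.ge, h.2.ge⟩⟩
      refine ⟨g.symm t, ?_⟩
      rw [Equiv.apply_symm_apply]
      exact ⟨rfl, rfl, rfl⟩
    · rintro ⟨i, h1, h2, -⟩
      have h3 := (g i).2
      rw [← h1, ← h2] at h3
      refine ⟨h3.1, fun h4 => ?_⟩
      have h5 := h3.1
      have h6 := h3.2
      have h7 : min m n ≤ A.rank := h4.1
      have h8 : min m n - 1 ≤ (posSpectrum A).card := h4.2
      omega
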